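/- \textbf{Conventions.} Manifolds are smooth, real, finite-dimensional, Hausdorff and without boundary; maps are smooth. Let $\mathfrak g$ be a real Lie algebra with a symmetric $\mathfrak g$-invariant element $t\in(S^2\mathfrak g)^{\mathfrak g}$, let $t^\sharp\alpha=t(\alpha,\cdot)$, and let $\phi\in\bigwedge^3\mathfrak g$ be given by $\phi(\alpha,\beta,\gamma)=\frac14\langle[t^\sharp\alpha,t^\sharp\beta],\gamma\rangle$ for $\alpha,\beta,\gamma\in\mathfrak g^*$. A \emph{$\mathfrak g$-quasi-Poisson manifold} $(M,\rho,\pi)$ is a manifold $M$ with an action of $\mathfrak g$ (a Lie algebra homomorphism $\rho$ from $\mathfrak g$ to vector fields on $M$) and a $\mathfrak g$-invariant bivector field $\pi$ such that $[\pi,\pi]/2=\rho^{\otimes3}(\phi)$, where $\frac12[\pi,\pi](df,dg,dh)=\{f,\{g,h\}\}+\{g,\{h,f\}\}+\{h,\{f,g\}\}$ with $\{f,g\}=\pi(df,dg)$. Put $\sigma=\pi+\frac12\rho^{\otimes2}(t)$. A function $f\in C^\infty(M)$ is \emph{left-central} if $\sigma(df,\cdot)=0$ and \emph{right-central} if $\sigma(\cdot,df)=0$;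 $M$ is \emph{quasi-Poisson-commutative} if $\sigma=0$. A map $F:M\to N$ from a $\mathfrak g$-quasi-Poisson manifold to a quasi-Poisson-commutative one is \emph{left (right) central} if it is $\mathfrak g$-equivariant and $F^*f$ is left- (right-) central for every $f\in C^\infty(N)$. A \emph{central pair} $N_L\xleftarrow{\ \mu_L\ }M\xrightarrow{\ \mu_R\ }N_R$ consists of a $\mathfrak g$-quasi-Poisson manifold $M$, quasi-Poisson-commutative $\mathfrak g$-manifolds $N_L,N_R$, a left central map $\mu_L$ and a right central map $\mu_R$. A map $F:M\to M'$ is \emph{quasi-Poisson} if it is $\mathfrak g$-equivariant and $F_*\pi_M=\pi_{M'}$. A \emph{$\mathfrak g$-quasi-Poisson submanifold} of $M$ is an embedded submanifold carrying a (necessarily unique) $\mathfrak g$-quasi-Poisson structure for which the inclusion is a quasi-Poisson map. The \emph{fusion product} $M_1\circledast M_2$ of $(M_1,\rho_1,\pi_1)$ and $(M_2,\rho_2,\pi_2)$ is $M_1\times M_2$ with the diagonal action of $\mathfrak g$ and the bivector field $\pi_\circledast=\pi_1+\pi_2-\frac12(\rho_1\wedge\rho_2)(t)$, where $(\rho_1\wedge\rho_2)(t)=(\rho_1\otimes\rho_2)(t)-(\rho_2\otimes\rho_1)(t)$.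 \textbf{Theorem.} Let $N\xleftarrow{\ \mu_L\ }M_1\xrightarrow{\ \mu_R\ }N'$ and $N'\xleftarrow{\ \nu_L\ }M_2\xrightarrow{\ \nu_R\ }N''$ be central pairs of $\mathfrak g$-quasi-Poisson manifolds, with the same quasi-Poisson-commutative structure on $N'$. Then $M_1\circledast M_2$ is a $\mathfrak g$-quasi-Poisson manifold. If $\mu_R\times\nu_L:M_1\times M_2\to N'\times N'$ is transverse to the diagonal $N'_{diag}\subset N'\times N'$ (which is the case if $\mu_R$ or $\nu_L$ is a submersion), then the fibre product $$M_1\times_{N'}M_2=\{(x,y)\in M_1\times M_2:\mu_R(x)=\nu_L(y)\}$$ is a $\mathfrak g$-quasi-Poisson submanifold of $M_1\circledast M_2$, and with the induced quasi-Poisson structure and the maps $(x,y)\mapsto\mu_L(x)$ and $(x,y)\mapsto\nu_R(y)$ it forms a central pair $$N\longleftarrow M_1\times_{N'}M_2\longrightarrow N''.$$ -/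

import Mathlib

open scoped Manifold ContDiff TensorProduct

noncomputable section

namespace QuasiPoisson

/-! ### The Lie algebra `𝔤` and the tensor `t` -/

section Algebra

variable {𝔤 : Type*} [LieRing 𝔤] [LieAlgebra ℝ 𝔤]

/-- `t(α, β) = ∑ tⁱʲ α(eᵢ) β(eⱼ)` for a tensor `t = ∑ tⁱʲ eᵢ ⊗ eⱼ` and `α, β ∈ 𝔤*`. -/
def tensorEval (t : 𝔤 ⊗[ℝ] 𝔤) (α β : Module.Dual ℝ 𝔤) : ℝ :=
  TensorProduct.dualDistrib ℝ 𝔤 𝔤 (α ⊗ₜ[ℝ] β) t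

/-- `t♯ α = t(α, ·) ∈ 𝔤`. -/
def sharp (t : 𝔤 ⊗[ℝ] 𝔤) (α : Module.Dual ℝ 𝔤) : 𝔤 :=
  TensorProduct.lid ℝ 𝔤 (LinearMap.rTensor 𝔤 α t)

/-- The three-vector `φ ∈ ⋀³ 𝔤` as a trilinear form on `𝔤*`:
`φ(α, β, γ) = ¼ ⟨[t♯ α, t♯ β], γ⟩`. -/
def phi (t : 𝔤 ⊗[ℝ] 𝔤) (α β γ : Module.Dual ℝ 𝔤) : ℝ :=
  (1 / 4) * γ ⁅sharp t α, sharp t β⁆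

end Algebra

/-! ### Quasi-Poisson manifolds -/

section Manifold

variable (𝔤 : Type*) [LieRing 𝔤] [LieAlgebra ℝ 𝔤]
  {E : Type*} [NormedAddCommGroup E] [NormedSpace ℝ E]
  {H : Type*} [TopologicalSpace H] (I : ModelWithCorners ℝ E H)
  (M : Type*) [TopologicalSpace M] [ChartedSpace H M]

/-- The raw data `(ρ, π)` on a manifold `M`: a linear map `ρ` from `𝔤` to vector fields and a
contravariant 2-tensor field `π`, i.e. a bilinear form on every cotangent space.
All conditions (smoothness, `ρ` is an action, `π` is a bivector field, ...) are in
`IsQuasiPoisson`. -/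
structure ActionTensor where
  /-- the vector field `ρ u` for `u : 𝔤` -/
  ρ : 𝔤 →ₗ[ℝ] ((x : M) → TangentSpace I x)
  /-- the 2-tensor field -/
  π : (x : M) → (TangentSpace I x →L[ℝ] ℝ) →ₗ[ℝ] (TangentSpace I x →L[ℝ] ℝ) →ₗ[ℝ] ℝ

namespace ActionTensor

variable {𝔤 I M} (Q : ActionTensor 𝔤 I M) (t : 𝔤 ⊗[ℝ] 𝔤)

/-- The map `ρₓ* : T*ₓM → 𝔤*` dual to `u ↦ ρ(u)ₓ`. -/
def coaction (x : M) (α : TangentSpace I x →L[ℝ] ℝ) : Module.Dual ℝ 𝔤 :=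
  α.toLinearMap ∘ₗ (LinearMap.proj x : ((y : M) → TangentSpace I y) →ₗ[ℝ] TangentSpace I x) ∘ₗ Q.ρ

/-- The tensor field `σ = π + ½ ρ^{⊗2}(t)`. -/
def sigma (x : M) (α β : TangentSpace I x →L[ℝ] ℝ) : ℝ :=
  Q.π x α β + (1 / 2) * tensorEval t (Q.coaction x α) (Q.coaction x β)

/-- The function `π(df, dg)`. -/
def bracket (f g : M → ℝ) : M → ℝ := fun x => Q.π x (mvfderiv I f x) (mvfderiv I g x)

/-- The function `ρ(u) f`. -/
def lieDeriv (u : 𝔤) (f : M → ℝ) : M → ℝ := fun x => mvfderiv I f x (Q.ρ u x)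

/-- `½ [π, π](df, dg, dh)`, half the Schouten bracket of a bivector field `π` with itself, which is
`{f, {g, h}} + {g, {h, f}} + {h, {f, g}}` for the bracket `{f, g} = π(df, dg)`
(normalised by `[X ∧ Y, X ∧ Y] = 2 [X, Y] ∧ X ∧ Y`). -/
def halfSchouten (f g h : M → ℝ) : M → ℝ := fun x =>
  Q.bracket f (Q.bracket g h) x + Q.bracket g (Q.bracket h f) x + Q.bracket h (Q.bracket f g) x

/-- `(M, ρ, π)` is a `𝔤`-quasi-Poisson manifold: `ρ` is an action of the Lie algebra `𝔤` on `M`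
by smooth vector fields, `π` is a smooth `𝔤`-invariant bivector field, and
`[π, π] / 2 = ρ^{⊗3}(φ)`. Tensor fields are tested on differentials of smooth functions. -/
structure IsQuasiPoisson [IsManifold I ∞ M] : Prop where
  smooth_action : ∀ u : 𝔤,
    ContMDiff I I.tangent ∞ (fun x => (⟨x, Q.ρ u x⟩ : TangentBundle I M))
  action_lie : ∀ (u v : 𝔤) (x : M),
    Q.ρ ⁅u, v⁆ x = VectorField.mlieBracket I (Q.ρ u) (Q.ρ v) x
  skew : ∀ (x : M) (α β : TangentSpace I x →L[ℝ] ℝ), Q.π x α β = -Q.π x β α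
  smooth_bivector : ∀ f g : M → ℝ, ContMDiff I 𝓘(ℝ, ℝ) ∞ f → ContMDiff I 𝓘(ℝ, ℝ) ∞ g →
    ContMDiff I 𝓘(ℝ, ℝ) ∞ (Q.bracket f g)
  invariant : ∀ (u : 𝔤) (f g : M → ℝ),
    ContMDiff I 𝓘(ℝ, ℝ) ∞ f → ContMDiff I 𝓘(ℝ, ℝ) ∞ g → ∀ x : M,
      Q.lieDeriv u (Q.bracket f g) x
        = Q.bracket (Q.lieDeriv u f) g x + Q.bracket f (Q.lieDeriv u g) x
  schouten : ∀ f g h : M → ℝ, ContMDiff I 𝓘(ℝ, ℝ) ∞ f → ContMDiff I 𝓘(ℝ, ℝ) ∞ g →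
    ContMDiff I 𝓘(ℝ, ℝ) ∞ h → ∀ x : M,
      Q.halfSchouten f g h x =
        phi t (Q.coaction x (mvfderiv I f x)) (Q.coaction x (mvfderiv I g x))
          (Q.coaction x (mvfderiv I h x))

/-- A `𝔤`-quasi-Poisson manifold with `σ = 0`. -/
structure IsQuasiPoissonCommutative [IsManifold I ∞ M] : Prop where
  isQuasiPoisson : Q.IsQuasiPoisson t
  sigma_eq_zero : ∀ (x : M) (α β : TangentSpace I x →L[ℝ] ℝ), Q.sigma t x α β = 0

/-- A smooth function `f` is left-central if `σ(df, ·) = 0`. -/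
def IsLeftCentral (f : M → ℝ) : Prop :=
  ∀ (x : M) (β : TangentSpace I x →L[ℝ] ℝ), Q.sigma t x (mvfderiv I f x) β = 0

/-- A smooth function `f` is right-central if `σ(·, df) = 0`. -/
def IsRightCentral (f : M → ℝ) : Prop :=
  ∀ (x : M) (α : TangentSpace I x →L[ℝ] ℝ), Q.sigma t x α (mvfderiv I f x) = 0

end ActionTensor

end Manifold

/-! ### Maps, central pairs, submanifolds and fusion -/

section Maps

variable {𝔤 : Type*} [LieRing 𝔤] [LieAlgebra ℝ 𝔤] (t : 𝔤 ⊗[ℝ] 𝔤)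
  {E : Type*} [NormedAddCommGroup E] [NormedSpace ℝ E]
  {H : Type*} [TopologicalSpace H] {I : ModelWithCorners ℝ E H}
  {M : Type*} [TopologicalSpace M] [ChartedSpace H M]
  {E' : Type*} [NormedAddCommGroup E'] [NormedSpace ℝ E']
  {H' : Type*} [TopologicalSpace H'] {I' : ModelWithCorners ℝ E' H'}
  {M' : Type*} [TopologicalSpace M'] [ChartedSpace H' M']
  {E'' : Type*} [NormedAddCommGroup E''] [NormedSpace ℝ E'']
  {H'' : Type*} [TopologicalSpace H''] {I'' : ModelWithCorners ℝ E'' H''}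
  {M'' : Type*} [TopologicalSpace M''] [ChartedSpace H'' M'']

/-- `F : M → M'` is `𝔤`-equivariant: `F_* (ρ_M u) = ρ_{M'} u`. -/
def IsEquivariant (Q : ActionTensor 𝔤 I M) (Q' : ActionTensor 𝔤 I' M') (F : M → M') : Prop :=
  ∀ (u : 𝔤) (x : M), mfderiv I I' F x (Q.ρ u x) = Q'.ρ u (F x)

/-- `F : M → M'` is a quasi-Poisson map: smooth, `𝔤`-equivariant and `F_* π_M = π_{M'}`. -/
structure IsQuasiPoissonMap (Q : ActionTensor 𝔤 I M) (Q' : ActionTensor 𝔤 I' M')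
    (F : M → M') : Prop where
  smooth : ContMDiff I I' ∞ F
  equivariant : IsEquivariant Q Q' F
  map_bivector : ∀ (x : M) (α β : TangentSpace I' (F x) →L[ℝ] ℝ),
    Q.π x (α.comp (mfderiv I I' F x)) (β.comp (mfderiv I I' F x)) = Q'.π (F x) α β

/-- A smooth `𝔤`-equivariant map `F : M → N` such that `F^* f` is left-central for every smooth
function `f` on `N`. -/
structure IsLeftCentralMap (Q : ActionTensor 𝔤 I M) (Q' : ActionTensor 𝔤 I' M')
    (F : M → M') : Prop where
  smooth : ContMDiff I I' ∞ F
  equivariant : IsEquivariant Q Q' F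
  central : ∀ f : M' → ℝ, ContMDiff I' 𝓘(ℝ, ℝ) ∞ f → Q.IsLeftCentral t (f ∘ F)

/-- A smooth `𝔤`-equivariant map `F : M → N` such that `F^* f` is right-central for every smooth
function `f` on `N`. -/
structure IsRightCentralMap (Q : ActionTensor 𝔤 I M) (Q' : ActionTensor 𝔤 I' M')
    (F : M → M') : Prop where
  smooth : ContMDiff I I' ∞ F
  equivariant : IsEquivariant Q Q' F
  central : ∀ f : M' → ℝ, ContMDiff I' 𝓘(ℝ, ℝ) ∞ f → Q.IsRightCentral t (f ∘ F)

/-- The diagram `N_L ← M → N_R` given by `μL` and `μR` is a central pair: `M` is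
`𝔤`-quasi-Poisson, `N_L` and `N_R` are quasi-Poisson-commutative, `μL` is a left central map and
`μR` is a right central map. -/
structure IsCentralPair [IsManifold I ∞ M] [IsManifold I' ∞ M'] [IsManifold I'' ∞ M'']
    (Q : ActionTensor 𝔤 I M) (QL : ActionTensor 𝔤 I' M')
    (QR : ActionTensor 𝔤 I'' M'') (μL : M → M') (μR : M → M'') : Prop where
  isQuasiPoisson : Q.IsQuasiPoisson t
  commutative_left : QL.IsQuasiPoissonCommutative t
  commutative_right : QR.IsQuasiPoissonCommutative t
  left_central : IsLeftCentralMap t Q QL μL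
  right_central : IsRightCentralMap t Q QR μR

/-- The subset `S ⊆ M`, with the subspace topology, the given manifold structure and the given
`(ρ_S, π_S)`, is a `𝔤`-quasi-Poisson submanifold of `(M, ρ, π)`: it is an embedded submanifold, it
is `𝔤`-quasi-Poisson, and the inclusion is a quasi-Poisson map. (The inclusion being a smooth
embedding, the manifold structure, `ρ_S` and `π_S` are determined by the subset `S`.) -/
structure IsQuasiPoissonSubmanifold (Q : ActionTensor 𝔤 I M) (S : Set M) [ChartedSpace H' S]
    [IsManifold I' ∞ S] (QS : ActionTensor 𝔤 I' S) : Prop where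
  embedded : Manifold.IsSmoothEmbedding I' I ∞ (Subtype.val : S → M)
  isQuasiPoisson : QS.IsQuasiPoisson t
  inclusion : IsQuasiPoissonMap QS Q (Subtype.val : S → M)

/-- The inclusion `TₓM → T₍ₓ,ᵧ₎(M × M') = TₓM ⊕ TᵧM'`. -/
def tangentInl (p : M × M') : TangentSpace I p.1 →L[ℝ] TangentSpace (I.prod I') p :=
  ContinuousLinearMap.inl ℝ (TangentSpace I p.1) (TangentSpace I' p.2)

/-- The inclusion `TᵧM' → T₍ₓ,ᵧ₎(M × M') = TₓM ⊕ TᵧM'`. -/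
def tangentInr (p : M × M') : TangentSpace I' p.2 →L[ℝ] TangentSpace (I.prod I') p :=
  ContinuousLinearMap.inr ℝ (TangentSpace I p.1) (TangentSpace I' p.2)

/-- The fusion product `M₁ ⊛ M₂`: the product manifold with the diagonal action and the bivector
field `π₁ + π₂ - ½ (ρ₁ ∧ ρ₂)(t)`, where `(ρ₁ ∧ ρ₂)(t) = (ρ₁ ⊗ ρ₂)(t) - (ρ₂ ⊗ ρ₁)(t)`. -/
def fusion (Q₁ : ActionTensor 𝔤 I M) (Q₂ : ActionTensor 𝔤 I' M') :
    ActionTensor 𝔤 (I.prod I') (M × M') where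
  ρ :=
    { toFun := fun u p => tangentInl p (Q₁.ρ u p.1) + tangentInr p (Q₂.ρ u p.2)
      map_add' := by
        intro u v; funext p
        simp only [map_add, Pi.add_apply]; abel
      map_smul' := by
        intro c u; funext p
        simp only [map_smul, Pi.smul_apply, RingHom.id_apply, smul_add] }
  π := fun p => LinearMap.mk₂ ℝ
    (fun α β =>
      Q₁.π p.1 (α.comp (tangentInl p)) (β.comp (tangentInl p))
        + Q₂.π p.2 (α.comp (tangentInr p)) (β.comp (tangentInr p))
        - (1 / 2) *
          (tensorEval t (Q₁.coaction p.1 (α.comp (tangentInl p)))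
              (Q₂.coaction p.2 (β.comp (tangentInr p)))
            - tensorEval t (Q₂.coaction p.2 (α.comp (tangentInr p)))
              (Q₁.coaction p.1 (β.comp (tangentInl p)))))
    (by
      intro α α' β
      simp only [tensorEval, ActionTensor.coaction, ContinuousLinearMap.add_comp,
        ContinuousLinearMap.toLinearMap_add, LinearMap.add_comp, TensorProduct.add_tmul, map_add,
        LinearMap.add_apply]
      ring)
    (by
      intro c α β
      simp only [tensorEval, ActionTensor.coaction, ContinuousLinearMap.smul_comp,
        ContinuousLinearMap.toLinearMap_smul, LinearMap.smul_comp, ← TensorProduct.smul_tmul',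
        map_smul, LinearMap.smul_apply, smul_eq_mul]
      ring)
    (by
      intro α β β'
      simp only [tensorEval, ActionTensor.coaction, ContinuousLinearMap.add_comp,
        ContinuousLinearMap.toLinearMap_add, LinearMap.add_comp, TensorProduct.tmul_add, map_add,
        LinearMap.add_apply]
      ring)
    (by
      intro c α β
      simp only [tensorEval, ActionTensor.coaction, ContinuousLinearMap.smul_comp,
        ContinuousLinearMap.toLinearMap_smul, LinearMap.smul_comp, TensorProduct.tmul_smul,
        map_smul, LinearMap.smul_apply, smul_eq_mul]
      ring)

/-- The fibre product `M₁ ×_N M₂ = {(x, y) | f x = g y}` of `f : M₁ → N` and `g : M₂ → N`. -/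
def fibreProduct {M₁ M₂ N : Type*} (f : M₁ → N) (g : M₂ → N) : Set (M₁ × M₂) :=
  {p | f p.1 = g p.2}

variable (I I' I'') in
/-- `f × g : M₁ × M₂ → N × N` is transverse to the diagonal of `N × N`: at every point of the
preimage of the diagonal, the image of the differential of `f × g` and the tangent space of the
diagonal (the image of the differential of `z ↦ (z, z)`) together span the tangent space of
`N × N` at `(f x, f x) = (f x, g y)`, which is the model space `E'' × E''` by definition. -/
def IsTransverseToDiagonal (f : M → M'') (g : M' → M'') : Prop :=
  ∀ (x : M) (y : M'), f x = g y →
    let dfg : E × E' →L[ℝ] E'' × E'' :=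
      mfderiv (I.prod I') (I''.prod I'') (Prod.map f g) (x, y)
    let ddiag : E'' →L[ℝ] E'' × E'' :=
      mfderiv I'' (I''.prod I'') (fun z : M'' => (z, z)) (f x)
    LinearMap.range dfg.toLinearMap ⊔ LinearMap.range ddiag.toLinearMap = ⊤

end Maps

end QuasiPoisson

end

noncomputable section

open Filter Topology

namespace QuasiPoisson

section Foundations

variable {E : Type*} [NormedAddCommGroup E] [NormedSpace ℝ E]
  {H : Type*} [TopologicalSpace H] {I : ModelWithCorners ℝ E H}
  {M : Type*} [TopologicalSpace M] [ChartedSpace H M]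

theorem mdifferentiableAt_of_contMDiff {f : M → ℝ} (hf : ContMDiff I 𝓘(ℝ, ℝ) ∞ f) (x : M) :
    MDifferentiableAt I 𝓘(ℝ, ℝ) f x :=
  hf.mdifferentiableAt (by simp)

section Boundaryless

variable [I.Boundaryless] [IsManifold I ∞ M]

theorem contDiffAt_comp_extChartAt_symm {f : M → ℝ} (hf : ContMDiff I 𝓘(ℝ, ℝ) ∞ f) (x : M)
    {z : E} (hz : z ∈ (extChartAt I x).target) :
    ContDiffAt ℝ ∞ (f ∘ (extChartAt I x).symm) z := by
  have h := (contMDiffOn_extChartAt_symm (I := I) (n := ∞) x).contMDiffAt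
    ((isOpen_extChartAt_target x).mem_nhds hz)
  exact (hf.contMDiffAt.comp z h).contDiffAt

/-- The differential of a function in a chart. -/
theorem mvfderiv_eq_fderiv_comp_mfderiv {f : M → ℝ} {x y : M}
    (hf : MDifferentiableAt I 𝓘(ℝ, ℝ) f y) (hy : y ∈ (extChartAt I x).source)
    (v : TangentSpace I y) :
    mvfderiv I f y v =
      fderiv ℝ (f ∘ (extChartAt I x).symm) (extChartAt I x y)
        (mfderiv I 𝓘(ℝ, E) (extChartAt I x) y v) := by
  have hy' : y ∈ (chartAt H x).source := by rwa [← extChartAt_source (I := I)]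
  have hz := (extChartAt I x).map_source hy
  have hs : MDifferentiableAt 𝓘(ℝ, E) I (extChartAt I x).symm (extChartAt I x y) := by
    have := (contMDiffOn_extChartAt_symm (I := I) (n := ∞) x).contMDiffAt
      ((isOpen_extChartAt_target x).mem_nhds hz)
    exact this.mdifferentiableAt (by simp)
  have hf' : MDifferentiableAt 𝓘(ℝ, E) 𝓘(ℝ, ℝ) (f ∘ (extChartAt I x).symm) (extChartAt I x y) := by
    refine MDifferentiableAt.comp _ ?_ hs
    rwa [(extChartAt I x).left_inv hy]
  have h1 : f =ᶠ[𝓝 y] (f ∘ (extChartAt I x).symm) ∘ extChartAt I x := by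
    filter_upwards [(isOpen_extChartAt_source (I := I) x).mem_nhds hy] with w hw
    exact congrArg f ((extChartAt I x).left_inv hw).symm
  have h2 : mfderiv I 𝓘(ℝ, ℝ) f y =
      mfderiv I 𝓘(ℝ, ℝ) ((f ∘ (extChartAt I x).symm) ∘ extChartAt I x) y :=
    h1.mfderiv_eq
  have h3 := mfderiv_comp y hf' (mdifferentiableAt_extChartAt hy')
  have h4 : mfderiv I 𝓘(ℝ, ℝ) f y v = mfderiv 𝓘(ℝ, E) 𝓘(ℝ, ℝ) (f ∘ (extChartAt I x).symm)
      (extChartAt I x y) (mfderiv I 𝓘(ℝ, E) (extChartAt I x) y v) := by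
    rw [h2, h3]; rfl
  rw [mfderiv_eq_fderiv] at h4
  exact h4

theorem mvfderiv_eq_fderiv_self {f : M → ℝ} {x : M}
    (hf : MDifferentiableAt I 𝓘(ℝ, ℝ) f x) (v : TangentSpace I x) :
    mvfderiv I f x v = fderiv ℝ (f ∘ (extChartAt I x).symm) (extChartAt I x x) v := by
  rw [mvfderiv_eq_fderiv_comp_mfderiv hf (mem_extChartAt_source x), mfderiv_extChartAt_self]
  rfl

/-- A vector field in the chart at `x`. -/
def inChart (x : M) (V : (y : M) → TangentSpace I y) (y : M) : E :=
  mfderiv I 𝓘(ℝ, E) (extChartAt I x) y (V y)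

omit [I.Boundaryless] in
theorem contMDiffAt_vectorField_iff {V : (y : M) → TangentSpace I y} {x : M} :
    ContMDiffAt I I.tangent ∞ (fun y => (⟨y, V y⟩ : TangentBundle I M)) x ↔
      ContMDiffAt I 𝓘(ℝ, E) ∞ (inChart x V) x := by
  refine (Bundle.contMDiffAt_section (IB := I) (F := E) (E := (TangentSpace I : M → Type _))
    (n := ∞) (s := V) x).trans ?_
  refine Filter.EventuallyEq.contMDiffAt_iff ?_
  filter_upwards [(chartAt H x).open_source.mem_nhds (mem_chart_source H x)] with y hy
  have := TangentBundle.continuousLinearMapAt_trivializationAt (I := I) hy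
  have h2 := DFunLike.congr_fun this (V y)
  rw [inChart]
  refine Eq.trans ?_ h2
  rw [Bundle.Trivialization.continuousLinearMapAt_apply, Bundle.Trivialization.linearMapAt_apply,
    if_pos (by simpa using hy)]

theorem contMDiffAt_mvfderiv_vectorField {V : (y : M) → TangentSpace I y} {x : M} {f : M → ℝ}
    (hV : ContMDiffAt I I.tangent ∞ (fun y => (⟨y, V y⟩ : TangentBundle I M)) x)
    (hf : ContMDiff I 𝓘(ℝ, ℝ) ∞ f) :
    ContMDiffAt I 𝓘(ℝ, ℝ) ∞ (fun y => mvfderiv I f y (V y)) x := by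
  rw [contMDiffAt_vectorField_iff] at hV
  have h1 : ContDiffAt ℝ ∞ (fderiv ℝ (f ∘ (extChartAt I x).symm)) (extChartAt I x x) :=
    (contDiffAt_comp_extChartAt_symm hf x (mem_extChartAt_target x)).fderiv_right (by simp)
  have h2 : ContMDiffAt I 𝓘(ℝ, E →L[ℝ] ℝ) ∞
      (fun y => fderiv ℝ (f ∘ (extChartAt I x).symm) (extChartAt I x y)) x :=
    h1.contMDiffAt.comp x contMDiffAt_extChartAt
  refine (h2.clm_apply hV).congr_of_eventuallyEq ?_
  filter_upwards [(isOpen_extChartAt_source (I := I) x).mem_nhds (mem_extChartAt_source x)]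
    with y hy
  exact mvfderiv_eq_fderiv_comp_mfderiv (mdifferentiableAt_of_contMDiff hf y) hy _

theorem contMDiff_mvfderiv_vectorField {V : (y : M) → TangentSpace I y} {f : M → ℝ}
    (hV : ContMDiff I I.tangent ∞ (fun y => (⟨y, V y⟩ : TangentBundle I M)))
    (hf : ContMDiff I 𝓘(ℝ, ℝ) ∞ f) :
    ContMDiff I 𝓘(ℝ, ℝ) ∞ (fun y => mvfderiv I f y (V y)) :=
  fun x => contMDiffAt_mvfderiv_vectorField (hV x) hf

omit [I.Boundaryless] in
theorem mpullbackWithin_extChartAt_symm_apply (V : (y : M) → TangentSpace I y) {x : M} {z : E}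
    (hz : z ∈ (extChartAt I x).target) :
    VectorField.mpullbackWithin 𝓘(ℝ, E) I (extChartAt I x).symm V (Set.range I) z =
      inChart x V ((extChartAt I x).symm z) := by
  rw [VectorField.mpullbackWithin_apply, inChart]
  have h := mfderivWithin_extChartAt_symm_comp_mfderiv_extChartAt (I := I) hz
  exact (isInvertible_mfderivWithin_extChartAt_symm hz).inverse_apply_eq.2
    (DFunLike.congr_fun h _).symm

/-- The Lie bracket of vector fields as a commutator of derivations. -/
theorem mvfderiv_mlieBracket {V W : (y : M) → TangentSpace I y}
    (hV : ContMDiff I I.tangent ∞ (fun y => (⟨y, V y⟩ : TangentBundle I M)))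
    (hW : ContMDiff I I.tangent ∞ (fun y => (⟨y, W y⟩ : TangentBundle I M)))
    {f : M → ℝ} (hf : ContMDiff I 𝓘(ℝ, ℝ) ∞ f) (x : M) :
    mvfderiv I f x (VectorField.mlieBracket I V W x) =
      mvfderiv I (fun y => mvfderiv I f y (W y)) x (V x)
        - mvfderiv I (fun y => mvfderiv I f y (V y)) x (W x) := by
  have hz := mem_extChartAt_target (I := I) x
  have hdiff : ∀ {U : (y : M) → TangentSpace I y},
      ContMDiff I I.tangent ∞ (fun y => (⟨y, U y⟩ : TangentBundle I M)) →
      DifferentiableAt ℝ (fun z => inChart x U ((extChartAt I x).symm z)) (extChartAt I x x) := by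
    intro U hU
    have h1 := contMDiffAt_vectorField_iff.1 (hU x)
    have h2 := (contMDiffOn_extChartAt_symm (I := I) (n := ∞) x).contMDiffAt
      ((isOpen_extChartAt_target x).mem_nhds hz)
    have h3 := (ContMDiffAt.comp_of_eq h1 h2 (extChartAt_to_inv x)).contDiffAt
    exact h3.differentiableAt (by simp)
  have hself : ∀ U : (y : M) → TangentSpace I y, inChart x U x = U x := by
    intro U; rw [inChart, mfderiv_extChartAt_self]; rfl
  have hsnd : DifferentiableAt ℝ (fderiv ℝ (f ∘ (extChartAt I x).symm)) (extChartAt I x x) :=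
    ((contDiffAt_comp_extChartAt_symm hf x hz).fderiv_right (m := ∞) (by simp)).differentiableAt
      (by simp)
  have hcomm : ∀ {U U' : (y : M) → TangentSpace I y},
      ContMDiff I I.tangent ∞ (fun y => (⟨y, U y⟩ : TangentBundle I M)) →
      mvfderiv I (fun y => mvfderiv I f y (U y)) x (U' x) =
        fderiv ℝ (fderiv ℝ (f ∘ (extChartAt I x).symm)) (extChartAt I x x) (U' x) (U x) +
        fderiv ℝ (f ∘ (extChartAt I x).symm) (extChartAt I x x)
          (fderiv ℝ (fun z => inChart x U ((extChartAt I x).symm z)) (extChartAt I x x) (U' x)) := by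
    intro U U' hU
    rw [mvfderiv_eq_fderiv_self
      (mdifferentiableAt_of_contMDiff (contMDiff_mvfderiv_vectorField hU hf) x)]
    have he : (fun y => mvfderiv I f y (U y)) ∘ (extChartAt I x).symm =ᶠ[𝓝 (extChartAt I x x)]
        fun z => fderiv ℝ (f ∘ (extChartAt I x).symm) z (inChart x U ((extChartAt I x).symm z)) := by
      filter_upwards [(isOpen_extChartAt_target (I := I) x).mem_nhds hz] with z hz
      have := mvfderiv_eq_fderiv_comp_mfderiv (mdifferentiableAt_of_contMDiff hf _)
        ((extChartAt I x).map_target hz) (U ((extChartAt I x).symm z))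
      rw [(extChartAt I x).right_inv hz] at this
      exact this
    rw [he.fderiv_eq, fderiv_clm_apply hsnd (hdiff hU)]
    simp only [extChartAt_to_inv, hself]
    rw [add_comm]
    rfl
  have hsymm : IsSymmSndFDerivAt ℝ (f ∘ (extChartAt I x).symm) (extChartAt I x x) :=
    (contDiffAt_comp_extChartAt_symm hf x hz).isSymmSndFDerivAt
      (by simpa using ENat.LEInfty.out)
  have hbr : VectorField.mlieBracket I V W x =
      (fderiv ℝ (fun z => inChart x W ((extChartAt I x).symm z)) (extChartAt I x x) (V x) -
      fderiv ℝ (fun z => inChart x V ((extChartAt I x).symm z)) (extChartAt I x x) (W x) : E) := by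
    rw [← VectorField.mlieBracketWithin_univ, VectorField.mlieBracketWithin_apply,
      mfderiv_extChartAt_self]
    simp only [Set.preimage_univ, Set.univ_inter]
    have hev : ∀ U : (y : M) → TangentSpace I y,
        VectorField.mpullbackWithin 𝓘(ℝ, E) I (extChartAt I x).symm U (Set.range I)
          =ᶠ[𝓝 (extChartAt I x x)] fun z => inChart x U ((extChartAt I x).symm z) := by
      intro U
      filter_upwards [(isOpen_extChartAt_target (I := I) x).mem_nhds hz] with z hz
      exact mpullbackWithin_extChartAt_symm_apply U hz
    have e1 := (hev V).lieBracket_vectorField_eq (𝕜 := ℝ) (hev W)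
    rw [I.range_eq_univ] at e1 ⊢
    rw [VectorField.lieBracket_eq] at e1
    simp only [extChartAt_to_inv, hself] at e1
    refine (DFunLike.congr_fun (ContinuousLinearMap.inverse_id (R := ℝ) (M := E)) _).trans ?_
    exact (congrFun VectorField.lieBracketWithin_univ _).trans e1
  rw [hcomm hW, hcomm hV, mvfderiv_eq_fderiv_self (mdifferentiableAt_of_contMDiff hf x), hbr,
    map_sub, hsymm.eq (V x) (W x)]
  ring

end Boundaryless

end Foundations

section Foundations

variable {E : Type*} [NormedAddCommGroup E] [NormedSpace ℝ E] [FiniteDimensional ℝ E]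
  {H : Type*} [TopologicalSpace H] {I : ModelWithCorners ℝ E H}
  {M : Type*} [TopologicalSpace M] [ChartedSpace H M] [I.Boundaryless] [IsManifold I ∞ M]

/-- Every covector is the differential of a globally defined smooth function. -/
theorem exists_contMDiff_mvfderiv_eq [T2Space M] (x : M) (α : TangentSpace I x →L[ℝ] ℝ) :
    ∃ f : M → ℝ, ContMDiff I 𝓘(ℝ, ℝ) ∞ f ∧ mvfderiv I f x = α := by
  let β : E →L[ℝ] ℝ := α
  let χ : SmoothBumpFunction I x := Classical.choice inferInstance
  let f : M → ℝ := fun y => χ y • β (extChartAt I x y)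
  have hf : ContMDiff I 𝓘(ℝ, ℝ) ∞ f := by
    refine χ.contMDiff_smul ?_
    exact β.contDiff.contMDiff.comp_contMDiffOn contMDiffOn_extChartAt
  refine ⟨f, hf, ?_⟩
  ext v
  rw [mvfderiv_eq_fderiv_self (mdifferentiableAt_of_contMDiff hf x)]
  have he : f ∘ (extChartAt I x).symm =ᶠ[𝓝 (extChartAt I x x)] β := by
    have h1 : Tendsto (extChartAt I x).symm (𝓝 (extChartAt I x x)) (𝓝 x) := by
      have := (continuousAt_extChartAt_symm (I := I) x).tendsto
      rwa [extChartAt_to_inv] at this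
    filter_upwards [(isOpen_extChartAt_target (I := I) x).mem_nhds (mem_extChartAt_target x),
      h1.eventually χ.eventuallyEq_one] with z hz hz1
    have hz2 : χ ((extChartAt I x).symm z) = 1 := hz1
    simp only [f, Function.comp, hz2, (extChartAt I x).right_inv hz, one_smul]
  rw [he.fderiv_eq, β.fderiv]
  rfl

omit [FiniteDimensional ℝ E] [I.Boundaryless] [IsManifold I ∞ M] in
theorem mvfderiv_fun_const_smul {f : M → ℝ} (c : ℝ) {x : M}
    (hf : MDifferentiableAt I 𝓘(ℝ, ℝ) f x) :
    mvfderiv I (fun y => c * f y) x = c • mvfderiv I f x := by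
  have := mvfderiv_fun_mul (I := I) (x := x) (f := fun _ => c) (g := f) mdifferentiableAt_const hf
  rw [this, mvfderiv_const]
  simp

/-- A set of smooth functions whose differentials span every cotangent space. -/
structure IsGenerating (I : ModelWithCorners ℝ E H) (S : Set (M → ℝ)) : Prop where
  smooth : ∀ g ∈ S, ContMDiff I 𝓘(ℝ, ℝ) ∞ g
  span : ∀ (x : M) (α : TangentSpace I x →L[ℝ] ℝ),
    α ∈ Submodule.span ℝ ((fun g : M → ℝ => mvfderiv I g x) '' S)

omit [FiniteDimensional ℝ E] [I.Boundaryless] [IsManifold I ∞ M] in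
theorem IsGenerating.linearMap_eq {S : Set (M → ℝ)} (hS : IsGenerating I S) {x : M}
    {A B : (TangentSpace I x →L[ℝ] ℝ) →ₗ[ℝ] ℝ}
    (h : ∀ g ∈ S, A (mvfderiv I g x) = B (mvfderiv I g x)) (α : TangentSpace I x →L[ℝ] ℝ) :
    A α = B α := by
  refine LinearMap.eqOn_span (s := (fun g : M → ℝ => mvfderiv I g x) '' S) ?_ (hS.span x α)
  rintro _ ⟨g, hg, rfl⟩
  exact h g hg

theorem IsGenerating.contMDiff_vectorField {S : Set (M → ℝ)} (hS : IsGenerating I S)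
    {V : (y : M) → TangentSpace I y}
    (hV : ∀ g ∈ S, ContMDiff I 𝓘(ℝ, ℝ) ∞ (fun y => mvfderiv I g y (V y))) :
    ContMDiff I I.tangent ∞ (fun y => (⟨y, V y⟩ : TangentBundle I M)) := by
  intro x
  have key : ∀ α : TangentSpace I x →L[ℝ] ℝ, ∃ g : M → ℝ, ContMDiff I 𝓘(ℝ, ℝ) ∞ g ∧
      ContMDiff I 𝓘(ℝ, ℝ) ∞ (fun y => mvfderiv I g y (V y)) ∧ mvfderiv I g x = α := by
    intro α
    induction hS.span x α using Submodule.span_induction with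
    | mem α h =>
      obtain ⟨g, hg, rfl⟩ := h
      exact ⟨g, hS.smooth g hg, hV g hg, rfl⟩
    | zero => exact ⟨fun _ => 0, contMDiff_const, by simp [mvfderiv_const, contMDiff_const],
        mvfderiv_const 0⟩
    | add α β _ _ h1 h2 =>
      obtain ⟨f, hf, hVf, rfl⟩ := h1
      obtain ⟨g, hg, hVg, rfl⟩ := h2
      have hadd : ∀ y, mvfderiv I (fun y => f y + g y) y = mvfderiv I f y + mvfderiv I g y :=
        fun y => mvfderiv_fun_add (mdifferentiableAt_of_contMDiff hf y)
          (mdifferentiableAt_of_contMDiff hg y)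
      refine ⟨fun y => f y + g y, hf.add hg, ?_, hadd x⟩
      simp only [hadd]
      exact hVf.add hVg
    | smul c α _ h1 =>
      obtain ⟨f, hf, hVf, rfl⟩ := h1
      have hsm : ∀ y, mvfderiv I (fun y => c * f y) y = c • mvfderiv I f y :=
        fun y => mvfderiv_fun_const_smul c (mdifferentiableAt_of_contMDiff hf y)
      refine ⟨fun y => c * f y, contMDiff_const.mul hf, ?_, hsm x⟩
      simp only [hsm]
      exact contMDiff_const.mul hVf
  let b := Module.finBasis ℝ E
  let α : Fin (Module.finrank ℝ E) → TangentSpace I x →L[ℝ] ℝ :=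
    fun i => (LinearMap.toContinuousLinearMap (b.coord i) : E →L[ℝ] ℝ)
  choose g hg hVg hgα using fun i => key (α i)
  let D : E → E →L[ℝ] E := fun z =>
    ∑ i, (fderiv ℝ (g i ∘ (extChartAt I x).symm) z).smulRight (b i)
  have hDx : D (extChartAt I x x) = ContinuousLinearMap.id ℝ E := by
    ext v
    simp only [D, sum_apply, ContinuousLinearMap.smulRight_apply,
      ContinuousLinearMap.id_apply]
    conv_rhs => rw [← b.sum_repr v]
    refine Finset.sum_congr rfl fun i _ => ?_
    rw [← mvfderiv_eq_fderiv_self (mdifferentiableAt_of_contMDiff (hg i) x) v, hgα i]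
    rfl
  have hD : ContDiffAt ℝ ∞ D (extChartAt I x x) := by
    refine ContDiffAt.sum fun i _ => ?_
    have h1 : ContDiffAt ℝ ∞ (fderiv ℝ (g i ∘ (extChartAt I x).symm)) (extChartAt I x x) :=
      (contDiffAt_comp_extChartAt_symm (hg i) x (mem_extChartAt_target x)).fderiv_right (by simp)
    exact h1.smulRight contDiffAt_const
  have hinv : ContDiffAt ℝ ∞ (ContinuousLinearMap.inverse ∘ D) (extChartAt I x x) := by
    have h1 := contDiffAt_map_inverse (n := ∞) (ContinuousLinearEquiv.refl ℝ E)
    refine ContDiffAt.comp _ ?_ hD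
    rw [hDx]
    exact h1
  rw [contMDiffAt_vectorField_iff]
  let w : M → E := fun y => ∑ i, mvfderiv I (g i) y (V y) • b i
  have hw : ContMDiffAt I 𝓘(ℝ, E) ∞ w x := by
    refine ContMDiffAt.sum fun i _ => ?_
    exact ((hVg i) x).smul contMDiffAt_const
  have hinv' : ContMDiffAt I 𝓘(ℝ, E →L[ℝ] E) ∞ (fun y => (D (extChartAt I x y)).inverse) x :=
    hinv.contMDiffAt.comp x contMDiffAt_extChartAt
  refine (hinv'.clm_apply hw).congr_of_eventuallyEq ?_
  have hev : ∀ᶠ y in 𝓝 x, (D (extChartAt I x y)).IsInvertible := by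
    have h1 : ∀ᶠ A in 𝓝 (ContinuousLinearMap.id ℝ E), A.IsInvertible :=
      (ContinuousLinearEquiv.refl ℝ E).nhds
    have h2 : Tendsto (fun y => D (extChartAt I x y)) (𝓝 x) (𝓝 (ContinuousLinearMap.id ℝ E)) := by
      rw [← hDx]
      exact (hD.continuousAt.comp (continuousAt_extChartAt x)).tendsto
    exact h2.eventually h1
  filter_upwards [(isOpen_extChartAt_source (I := I) x).mem_nhds (mem_extChartAt_source x), hev]
    with y hy hinvy
  symm
  rw [hinvy.inverse_apply_eq]
  simp only [w, D, sum_apply, ContinuousLinearMap.smulRight_apply]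
  refine Finset.sum_congr rfl fun i _ => ?_
  rw [mvfderiv_eq_fderiv_comp_mfderiv (mdifferentiableAt_of_contMDiff (hg i) y) hy]
  rfl

theorem exists_forall_apply_eq {V : Type*} [NormedAddCommGroup V] [NormedSpace ℝ V]
    [FiniteDimensional ℝ V] (L : (V →L[ℝ] ℝ) →ₗ[ℝ] ℝ) : ∃ v : V, ∀ α : V →L[ℝ] ℝ, α v = L α := by
  let L' : Module.Dual ℝ (Module.Dual ℝ V) :=
    L ∘ₗ (LinearMap.toContinuousLinearMap (E := V) (F' := ℝ)).toLinearMap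
  exact ⟨(Module.evalEquiv ℝ V).symm L', fun α =>
    Module.apply_evalEquiv_symm_apply ℝ V (α : V →ₗ[ℝ] ℝ) L'⟩

omit [I.Boundaryless] [IsManifold I ∞ M] in
/-- A linear form on the cotangent space is the evaluation at a tangent vector. -/
theorem exists_tangentVector (x : M) (L : (TangentSpace I x →L[ℝ] ℝ) →ₗ[ℝ] ℝ) :
    ∃ v : TangentSpace I x, ∀ α : TangentSpace I x →L[ℝ] ℝ, α v = L α :=
  exists_forall_apply_eq (V := E) L

end Foundations

section Tensor

variable {𝔤 : Type*} [LieRing 𝔤] [LieAlgebra ℝ 𝔤] {t : 𝔤 ⊗[ℝ] 𝔤}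

theorem tensorEval_eq_sum {S : Finset (𝔤 × 𝔤)} (hS : t = ∑ i ∈ S, i.1 ⊗ₜ[ℝ] i.2)
    (α β : Module.Dual ℝ 𝔤) : tensorEval t α β = ∑ i ∈ S, α i.1 * β i.2 := by
  rw [tensorEval, hS, map_sum]
  simp

theorem sharp_eq_sum {S : Finset (𝔤 × 𝔤)} (hS : t = ∑ i ∈ S, i.1 ⊗ₜ[ℝ] i.2)
    (α : Module.Dual ℝ 𝔤) : sharp t α = ∑ i ∈ S, α i.1 • i.2 := by
  rw [sharp, hS, map_sum, map_sum]
  simp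

theorem tensorEval_eq_apply_sharp (α β : Module.Dual ℝ 𝔤) :
    tensorEval t α β = β (sharp t α) := by
  obtain ⟨S, hS⟩ := TensorProduct.exists_finset t
  rw [tensorEval_eq_sum hS, sharp_eq_sum hS, map_sum]
  simp

theorem tensorEval_swap (ht_symm : TensorProduct.comm ℝ 𝔤 𝔤 t = t) (α β : Module.Dual ℝ 𝔤) :
    tensorEval t α β = tensorEval t β α := by
  obtain ⟨S, hS⟩ := TensorProduct.exists_finset t
  rw [tensorEval_eq_sum hS]
  rw [tensorEval, ← ht_symm, hS, map_sum, map_sum]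
  simp [mul_comm]

theorem tensorEval_ad (ht_inv : ∀ u : 𝔤, ⁅u, t⁆ = 0) (u : 𝔤) (α β : Module.Dual ℝ 𝔤) :
    tensorEval t (α ∘ₗ LieModule.toEnd ℝ 𝔤 𝔤 u) β +
      tensorEval t α (β ∘ₗ LieModule.toEnd ℝ 𝔤 𝔤 u) = 0 := by
  obtain ⟨S, hS⟩ := TensorProduct.exists_finset t
  have h := congrArg (TensorProduct.dualDistrib ℝ 𝔤 𝔤 (α ⊗ₜ[ℝ] β)) (ht_inv u)
  rw [hS, lie_sum, map_sum, map_zero] at h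
  rw [tensorEval_eq_sum hS, tensorEval_eq_sum hS, ← Finset.sum_add_distrib, ← h]
  simp [TensorProduct.LieModule.lie_tmul_right]

theorem phi_cyclic (ht_symm : TensorProduct.comm ℝ 𝔤 𝔤 t = t) (ht_inv : ∀ u : 𝔤, ⁅u, t⁆ = 0)
    (α β γ : Module.Dual ℝ 𝔤) : phi t α β γ = phi t β γ α := by
  have h := tensorEval_ad ht_inv (sharp t β) γ α
  rw [tensorEval_eq_apply_sharp γ, tensorEval_swap ht_symm, tensorEval_eq_apply_sharp α] at h
  simp only [LinearMap.comp_apply, LieModule.toEnd_apply_apply] at h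
  rw [phi, phi, ← lie_skew, map_neg]
  linarith

/-- `φ(·, β, γ)` as a linear form. -/
def phiLeft (t : 𝔤 ⊗[ℝ] 𝔤) (β γ : Module.Dual ℝ 𝔤) : Module.Dual ℝ 𝔤 →ₗ[ℝ] ℝ where
  toFun α := phi t α β γ
  map_add' α α' := by
    simp [phi, sharp, LinearMap.rTensor_add, add_lie, mul_add]
  map_smul' c α := by
    simp [phi, sharp, LinearMap.rTensor_smul, smul_lie]
    ring

end Tensor

section Generators

variable {𝔤 : Type*} [LieRing 𝔤] [LieAlgebra ℝ 𝔤] {t : 𝔤 ⊗[ℝ] 𝔤}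
  {E : Type*} [NormedAddCommGroup E] [NormedSpace ℝ E] [FiniteDimensional ℝ E]
  {H : Type*} [TopologicalSpace H] {I : ModelWithCorners ℝ E H}
  {M : Type*} [TopologicalSpace M] [ChartedSpace H M]

/-- Evaluation of covectors at a tangent vector. -/
def evalTangent {x : M} (v : TangentSpace I x) : (TangentSpace I x →L[ℝ] ℝ) →ₗ[ℝ] ℝ where
  toFun α := α v
  map_add' _ _ := rfl
  map_smul' _ _ := rfl

namespace ActionTensor

variable (Q : ActionTensor 𝔤 I M)

/-- The coaction as a linear map. -/
def coactionLinear (x : M) : (TangentSpace I x →L[ℝ] ℝ) →ₗ[ℝ] Module.Dual ℝ 𝔤 where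
  toFun := Q.coaction x
  map_add' _ _ := rfl
  map_smul' _ _ := rfl

/-- The Hamiltonian vector field `π(df, ·)`. -/
def hamiltonian (f : M → ℝ) (x : M) : TangentSpace I x :=
  (exists_tangentVector x (Q.π x (mvfderiv I f x))).choose

theorem apply_hamiltonian (f : M → ℝ) (x : M) (α : TangentSpace I x →L[ℝ] ℝ) :
    α (Q.hamiltonian f x) = Q.π x (mvfderiv I f x) α :=
  (exists_tangentVector x (Q.π x (mvfderiv I f x))).choose_spec α

theorem bracket_eq_hamiltonian (f g : M → ℝ) :
    Q.bracket f g = fun x => mvfderiv I g x (Q.hamiltonian f x) := by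
  funext x
  rw [apply_hamiltonian]
  rfl

variable [I.Boundaryless] [IsManifold I ∞ M] {Q}

omit [FiniteDimensional ℝ E] [I.Boundaryless] [IsManifold I ∞ M] in
theorem bracket_swap (hskew : ∀ (x : M) (α β : TangentSpace I x →L[ℝ] ℝ), Q.π x α β = -Q.π x β α)
    (f g : M → ℝ) : Q.bracket f g = -Q.bracket g f :=
  funext fun x => hskew x _ _

omit [FiniteDimensional ℝ E] [I.Boundaryless] [IsManifold I ∞ M] in
theorem bracket_neg_right (f g : M → ℝ) (x : M) :
    Q.bracket f (-g) x = -Q.bracket f g x := by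
  simp [bracket, mvfderiv_neg]

omit [FiniteDimensional ℝ E] [I.Boundaryless] [IsManifold I ∞ M] in
theorem lieDeriv_neg (u : 𝔤) (f : M → ℝ) (x : M) :
    Q.lieDeriv u (-f) x = -Q.lieDeriv u f x := by
  simp [lieDeriv, mvfderiv_neg]

section Tensoriality

variable (hskew : ∀ (x : M) (α β : TangentSpace I x →L[ℝ] ℝ), Q.π x α β = -Q.π x β α)
  (hρ : ∀ u : 𝔤, ContMDiff I I.tangent ∞ (fun x => (⟨x, Q.ρ u x⟩ : TangentBundle I M)))
  (hX : ∀ f : M → ℝ, ContMDiff I 𝓘(ℝ, ℝ) ∞ f →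
    ContMDiff I I.tangent ∞ (fun x => (⟨x, Q.hamiltonian f x⟩ : TangentBundle I M)))

include hskew hX in
/-- The Jacobiator is tensorial in its first argument. -/
theorem halfSchouten_eq_mvfderiv {f g h : M → ℝ} (hf : ContMDiff I 𝓘(ℝ, ℝ) ∞ f)
    (hg : ContMDiff I 𝓘(ℝ, ℝ) ∞ g) (hh : ContMDiff I 𝓘(ℝ, ℝ) ∞ h) (x : M) :
    Q.halfSchouten f g h x =
      mvfderiv I f x (VectorField.mlieBracket I (Q.hamiltonian g) (Q.hamiltonian h) x
        - Q.hamiltonian (Q.bracket g h) x) := by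
  rw [map_sub, mvfderiv_mlieBracket (hX g hg) (hX h hh) hf, halfSchouten,
    bracket_swap hskew f (Q.bracket g h), bracket_swap hskew f g, bracket_neg_right]
  rw [Pi.neg_apply, congrFun (bracket_eq_hamiltonian Q (Q.bracket g h) f) x,
    congrFun (bracket_eq_hamiltonian Q g (Q.bracket h f)) x, bracket_eq_hamiltonian Q h f,
    congrFun (bracket_eq_hamiltonian Q h (Q.bracket g f)) x, bracket_eq_hamiltonian Q g f]
  ring

include hskew hρ hX in
/-- The failure of invariance is tensorial in its first argument. -/
theorem invariance_defect_eq_mvfderiv {f g : M → ℝ} (hf : ContMDiff I 𝓘(ℝ, ℝ) ∞ f)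
    (hg : ContMDiff I 𝓘(ℝ, ℝ) ∞ g) (u : 𝔤) (x : M) :
    Q.lieDeriv u (Q.bracket f g) x
        - (Q.bracket (Q.lieDeriv u f) g x + Q.bracket f (Q.lieDeriv u g) x) =
      mvfderiv I f x (Q.hamiltonian (Q.lieDeriv u g) x
        - VectorField.mlieBracket I (Q.ρ u) (Q.hamiltonian g) x) := by
  rw [map_sub, mvfderiv_mlieBracket (hρ u) (hX g hg) hf, bracket_swap hskew f g,
    bracket_swap hskew f, bracket_swap hskew _ g, lieDeriv_neg]
  simp only [Pi.neg_apply, bracket_eq_hamiltonian]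
  simp only [lieDeriv]
  rw [show Q.lieDeriv u f = fun y => mvfderiv I f y (Q.ρ u y) from rfl]
  ring

end Tensoriality

/-- It suffices to check the axioms of a quasi-Poisson manifold on functions whose differentials
span the cotangent spaces. -/
theorem IsQuasiPoisson.of_isGenerating (ht_symm : TensorProduct.comm ℝ 𝔤 𝔤 t = t)
    (ht_inv : ∀ u : 𝔤, ⁅u, t⁆ = 0) {S : Set (M → ℝ)} (hS : IsGenerating I S)
    (smooth_lieDeriv : ∀ u, ∀ f ∈ S, ContMDiff I 𝓘(ℝ, ℝ) ∞ (Q.lieDeriv u f))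
    (lieDeriv_lie : ∀ u v, ∀ f ∈ S, ∀ x, Q.lieDeriv ⁅u, v⁆ f x =
      Q.lieDeriv u (Q.lieDeriv v f) x - Q.lieDeriv v (Q.lieDeriv u f) x)
    (skew : ∀ (x : M) (α β : TangentSpace I x →L[ℝ] ℝ), Q.π x α β = -Q.π x β α)
    (smooth_bracket : ∀ f ∈ S, ∀ g ∈ S, ContMDiff I 𝓘(ℝ, ℝ) ∞ (Q.bracket f g))
    (invariant : ∀ u, ∀ f ∈ S, ∀ g ∈ S, ∀ x, Q.lieDeriv u (Q.bracket f g) x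
        = Q.bracket (Q.lieDeriv u f) g x + Q.bracket f (Q.lieDeriv u g) x)
    (schouten : ∀ f ∈ S, ∀ g ∈ S, ∀ h ∈ S, ∀ x, Q.halfSchouten f g h x =
        phi t (Q.coaction x (mvfderiv I f x)) (Q.coaction x (mvfderiv I g x))
          (Q.coaction x (mvfderiv I h x))) :
    Q.IsQuasiPoisson t := by
  have hρ : ∀ u : 𝔤, ContMDiff I I.tangent ∞ (fun x => (⟨x, Q.ρ u x⟩ : TangentBundle I M)) :=
    fun u => hS.contMDiff_vectorField (smooth_lieDeriv u)
  have hXS : ∀ f ∈ S, ContMDiff I I.tangent ∞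
      (fun x => (⟨x, Q.hamiltonian f x⟩ : TangentBundle I M)) := fun f hf =>
    hS.contMDiff_vectorField fun g hg => by
      rw [← bracket_eq_hamiltonian]; exact smooth_bracket f hf g hg
  have hX : ∀ f : M → ℝ, ContMDiff I 𝓘(ℝ, ℝ) ∞ f → ContMDiff I I.tangent ∞
      (fun x => (⟨x, Q.hamiltonian f x⟩ : TangentBundle I M)) := fun f hf =>
    hS.contMDiff_vectorField fun g hg => by
      rw [← bracket_eq_hamiltonian, bracket_swap skew, bracket_eq_hamiltonian]
      exact (contMDiff_mvfderiv_vectorField (hXS g hg) hf).neg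
  refine ⟨hρ, ?_, skew, ?_, ?_, ?_⟩
  · intro u v x
    have h : ∀ α : TangentSpace I x →L[ℝ] ℝ, α (Q.ρ ⁅u, v⁆ x) =
        α (VectorField.mlieBracket I (Q.ρ u) (Q.ρ v) x) := by
      intro α
      refine hS.linearMap_eq
        (A := evalTangent (Q.ρ ⁅u, v⁆ x))
        (B := evalTangent (VectorField.mlieBracket I (Q.ρ u) (Q.ρ v) x)) ?_ α
      intro g hg
      refine (lieDeriv_lie u v g hg x).trans ?_
      exact (mvfderiv_mlieBracket (hρ u) (hρ v) (hS.smooth g hg) x).symm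
    exact (SeparatingDual.eq_iff_forall_dual_eq (R := ℝ) (V := E)).2 h
  · intro f g hf hg
    rw [bracket_eq_hamiltonian]
    exact contMDiff_mvfderiv_vectorField (hX f hf) hg
  · have hswap : ∀ u {f g : M → ℝ} (x : M), Q.lieDeriv u (Q.bracket f g) x
        = Q.bracket (Q.lieDeriv u f) g x + Q.bracket f (Q.lieDeriv u g) x →
        Q.lieDeriv u (Q.bracket g f) x
        = Q.bracket (Q.lieDeriv u g) f x + Q.bracket g (Q.lieDeriv u f) x := by
      intro u f g x h
      rw [bracket_swap skew g f, bracket_swap skew g, bracket_swap skew _ f, lieDeriv_neg, h]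
      simp only [Pi.neg_apply]
      ring
    have hext : ∀ u {g : M → ℝ}, ContMDiff I 𝓘(ℝ, ℝ) ∞ g → ∀ x, (∀ f ∈ S,
        Q.lieDeriv u (Q.bracket f g) x
          = Q.bracket (Q.lieDeriv u f) g x + Q.bracket f (Q.lieDeriv u g) x) →
        ∀ f : M → ℝ, ContMDiff I 𝓘(ℝ, ℝ) ∞ f → Q.lieDeriv u (Q.bracket f g) x
          = Q.bracket (Q.lieDeriv u f) g x + Q.bracket f (Q.lieDeriv u g) x := by
      intro u g hg x h f hf
      rw [← sub_eq_zero, invariance_defect_eq_mvfderiv skew hρ hX hf hg]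
      refine hS.linearMap_eq (A := evalTangent
        (Q.hamiltonian (Q.lieDeriv u g) x
          - VectorField.mlieBracket I (Q.ρ u) (Q.hamiltonian g) x)) (B := 0) ?_ _
      intro f hf
      refine (invariance_defect_eq_mvfderiv skew hρ hX (hS.smooth f hf) hg u x).symm.trans ?_
      rw [h f hf, sub_self]; rfl
    intro u f g hf hg x
    refine hext u hg x (fun f hf => ?_) f hf
    exact hswap u x (hext u (hS.smooth f hf) x (fun g hg => invariant u g hg f hf x) g hg)
  · let P : (M → ℝ) → (M → ℝ) → (M → ℝ) → M → Prop := fun f g h x => Q.halfSchouten f g h x =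
        phi t (Q.coaction x (mvfderiv I f x)) (Q.coaction x (mvfderiv I g x))
          (Q.coaction x (mvfderiv I h x))
    have hcyc : ∀ {f g h : M → ℝ} {x : M}, P f g h x → P g h f x := by
      intro f g h x hP
      simp only [P] at hP ⊢
      rw [← phi_cyclic ht_symm ht_inv, ← hP, halfSchouten, halfSchouten]
      ring
    have hext : ∀ {g h : M → ℝ}, ContMDiff I 𝓘(ℝ, ℝ) ∞ g → ContMDiff I 𝓘(ℝ, ℝ) ∞ h → ∀ x,
        (∀ f ∈ S, P f g h x) → ∀ f : M → ℝ, ContMDiff I 𝓘(ℝ, ℝ) ∞ f → P f g h x := by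
      intro g h hg hh x hP f hf
      simp only [P] at hP ⊢
      rw [halfSchouten_eq_mvfderiv skew hX hf hg hh]
      refine hS.linearMap_eq (A := evalTangent
        (VectorField.mlieBracket I (Q.hamiltonian g) (Q.hamiltonian h) x
          - Q.hamiltonian (Q.bracket g h) x))
        (B := phiLeft t (Q.coaction x (mvfderiv I g x)) (Q.coaction x (mvfderiv I h x)) ∘ₗ
          Q.coactionLinear x) ?_ _
      intro f hf
      exact (halfSchouten_eq_mvfderiv skew hX (hS.smooth f hf) hg hh x).symm.trans (hP f hf)
    intro f g h hf hg hh x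
    refine hext hg hh x (fun f hf => ?_) f hf
    refine hcyc (hcyc (hext hh (hS.smooth f hf) x (fun g hg => ?_) g hg))
    refine hcyc (hcyc (hext (hS.smooth f hf) (hS.smooth g hg) x (fun h hh => ?_) h hh))
    exact schouten h hh f hf g hg x

end ActionTensor

end Generators

section Leibniz

variable {𝔤 : Type*} [LieRing 𝔤] [LieAlgebra ℝ 𝔤] {t : 𝔤 ⊗[ℝ] 𝔤}
  {E : Type*} [NormedAddCommGroup E] [NormedSpace ℝ E]
  {H : Type*} [TopologicalSpace H] {I : ModelWithCorners ℝ E H}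
  {M : Type*} [TopologicalSpace M] [ChartedSpace H M]

theorem sharp_eq_sum_swap (ht_symm : TensorProduct.comm ℝ 𝔤 𝔤 t = t) {S : Finset (𝔤 × 𝔤)}
    (hS : t = ∑ i ∈ S, i.1 ⊗ₜ[ℝ] i.2) (α : Module.Dual ℝ 𝔤) :
    sharp t α = ∑ i ∈ S, α i.2 • i.1 := by
  rw [sharp, ← ht_symm, hS, map_sum, map_sum, map_sum]
  simp

theorem mvfderiv_const_mul_sum_mul {ι : Type*} (S : Finset ι) (c : ℝ) {A B : ι → M → ℝ}
    (hA : ∀ i, ContMDiff I 𝓘(ℝ, ℝ) ∞ (A i)) (hB : ∀ i, ContMDiff I 𝓘(ℝ, ℝ) ∞ (B i)) (x : M) :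
    mvfderiv I (fun x => c * ∑ i ∈ S, A i x * B i x) x =
      c • ∑ i ∈ S, (A i x • mvfderiv I (B i) x + B i x • mvfderiv I (A i) x) := by
  have hs : ∀ S : Finset ι, ContMDiff I 𝓘(ℝ, ℝ) ∞ (fun x => ∑ i ∈ S, A i x * B i x) := fun S =>
    contMDiff_finsetSum fun i _ => (hA i).mul (hB i)
  rw [mvfderiv_fun_const_smul c (mdifferentiableAt_of_contMDiff (hs S) x)]
  congr 1
  classical
  induction S using Finset.induction_on with
  | empty => simp [mvfderiv_const]
  | insert i S hi ih =>
    simp only [Finset.sum_insert hi]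
    rw [mvfderiv_fun_add (g := fun x => A i x * B i x)
      (mdifferentiableAt_of_contMDiff ((hA i).mul (hB i)) x)
      (mdifferentiableAt_of_contMDiff (hs S) x), ih,
      mvfderiv_fun_mul (mdifferentiableAt_of_contMDiff (hA i) x)
        (mdifferentiableAt_of_contMDiff (hB i) x)]

namespace ActionTensor

variable (Q : ActionTensor 𝔤 I M)

theorem bracket_const_mul_sum_mul {ι : Type*} (S : Finset ι) (c : ℝ) {A B : ι → M → ℝ}
    (hA : ∀ i, ContMDiff I 𝓘(ℝ, ℝ) ∞ (A i)) (hB : ∀ i, ContMDiff I 𝓘(ℝ, ℝ) ∞ (B i))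
    (f : M → ℝ) (x : M) :
    Q.bracket f (fun x => c * ∑ i ∈ S, A i x * B i x) x =
      c * ∑ i ∈ S, (A i x * Q.bracket f (B i) x + B i x * Q.bracket f (A i) x) := by
  rw [bracket, mvfderiv_const_mul_sum_mul S c hA hB]
  simp [map_sum, bracket]

theorem lieDeriv_const_mul_sum_mul {ι : Type*} (S : Finset ι) (c : ℝ) {A B : ι → M → ℝ}
    (hA : ∀ i, ContMDiff I 𝓘(ℝ, ℝ) ∞ (A i)) (hB : ∀ i, ContMDiff I 𝓘(ℝ, ℝ) ∞ (B i))
    (u : 𝔤) (x : M) :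
    Q.lieDeriv u (fun x => c * ∑ i ∈ S, A i x * B i x) x =
      c * ∑ i ∈ S, (A i x * Q.lieDeriv u (B i) x + B i x * Q.lieDeriv u (A i) x) := by
  rw [lieDeriv, mvfderiv_const_mul_sum_mul S c hA hB]
  simp [lieDeriv]

theorem coaction_mvfderiv (f : M → ℝ) (x : M) (u : 𝔤) :
    Q.coaction x (mvfderiv I f x) u = Q.lieDeriv u f x := rfl

variable {Q} [I.Boundaryless] [IsManifold I ∞ M]

theorem IsQuasiPoisson.contMDiff_lieDeriv (hQ : Q.IsQuasiPoisson t) (u : 𝔤) {f : M → ℝ}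
    (hf : ContMDiff I 𝓘(ℝ, ℝ) ∞ f) : ContMDiff I 𝓘(ℝ, ℝ) ∞ (Q.lieDeriv u f) :=
  contMDiff_mvfderiv_vectorField (hQ.smooth_action u) hf

theorem IsQuasiPoisson.lieDeriv_lie (hQ : Q.IsQuasiPoisson t) (u v : 𝔤) {f : M → ℝ}
    (hf : ContMDiff I 𝓘(ℝ, ℝ) ∞ f) (x : M) : Q.lieDeriv ⁅u, v⁆ f x =
      Q.lieDeriv u (Q.lieDeriv v f) x - Q.lieDeriv v (Q.lieDeriv u f) x := by
  rw [lieDeriv, hQ.action_lie,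
    mvfderiv_mlieBracket (hQ.smooth_action u) (hQ.smooth_action v) hf]
  rfl

end ActionTensor

end Leibniz

section Product

variable {E₁ : Type*} [NormedAddCommGroup E₁] [NormedSpace ℝ E₁]
  {H₁ : Type*} [TopologicalSpace H₁] {I₁ : ModelWithCorners ℝ E₁ H₁}
  {M₁ : Type*} [TopologicalSpace M₁] [ChartedSpace H₁ M₁]
  {E₂ : Type*} [NormedAddCommGroup E₂] [NormedSpace ℝ E₂]
  {H₂ : Type*} [TopologicalSpace H₂] {I₂ : ModelWithCorners ℝ E₂ H₂}
  {M₂ : Type*} [TopologicalSpace M₂] [ChartedSpace H₂ M₂]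

theorem mvfderiv_comp_fst_apply {a : M₁ → ℝ} {p : M₁ × M₂}
    (ha : MDifferentiableAt I₁ 𝓘(ℝ, ℝ) a p.1) (v : TangentSpace (I₁.prod I₂) p) :
    mvfderiv (I₁.prod I₂) (a ∘ Prod.fst) p v = mvfderiv I₁ a p.1 (v : E₁ × E₂).1 := by
  rw [mvfderiv_comp_apply p ha mdifferentiableAt_fst, mfderiv_fst]
  rfl

theorem mvfderiv_comp_snd_apply {b : M₂ → ℝ} {p : M₁ × M₂}
    (hb : MDifferentiableAt I₂ 𝓘(ℝ, ℝ) b p.2) (v : TangentSpace (I₁.prod I₂) p) :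
    mvfderiv (I₁.prod I₂) (b ∘ Prod.snd) p v = mvfderiv I₂ b p.2 (v : E₁ × E₂).2 := by
  rw [mvfderiv_comp_apply p hb mdifferentiableAt_snd, mfderiv_snd]
  rfl

theorem mvfderiv_comp_fst_comp_tangentInl {a : M₁ → ℝ} {p : M₁ × M₂}
    (ha : MDifferentiableAt I₁ 𝓘(ℝ, ℝ) a p.1) :
    (mvfderiv (I₁.prod I₂) (a ∘ Prod.fst) p).comp (tangentInl p) = mvfderiv I₁ a p.1 := by
  ext v
  exact mvfderiv_comp_fst_apply ha _

theorem mvfderiv_comp_fst_comp_tangentInr {a : M₁ → ℝ} {p : M₁ × M₂}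
    (ha : MDifferentiableAt I₁ 𝓘(ℝ, ℝ) a p.1) :
    (mvfderiv (I₁.prod I₂) (a ∘ Prod.fst) p).comp (tangentInr p) = 0 := by
  ext v
  exact (mvfderiv_comp_fst_apply ha _).trans (map_zero _)

theorem mvfderiv_comp_snd_comp_tangentInl {b : M₂ → ℝ} {p : M₁ × M₂}
    (hb : MDifferentiableAt I₂ 𝓘(ℝ, ℝ) b p.2) :
    (mvfderiv (I₁.prod I₂) (b ∘ Prod.snd) p).comp (tangentInl p) = 0 := by
  ext v
  exact (mvfderiv_comp_snd_apply hb _).trans (map_zero _)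

theorem mvfderiv_comp_snd_comp_tangentInr {b : M₂ → ℝ} {p : M₁ × M₂}
    (hb : MDifferentiableAt I₂ 𝓘(ℝ, ℝ) b p.2) :
    (mvfderiv (I₁.prod I₂) (b ∘ Prod.snd) p).comp (tangentInr p) = mvfderiv I₂ b p.2 := by
  ext v
  exact mvfderiv_comp_snd_apply hb _

/-- The pullbacks of smooth functions from both factors. -/
def factorFunctions (I₁ : ModelWithCorners ℝ E₁ H₁) (I₂ : ModelWithCorners ℝ E₂ H₂)
    (M₁ : Type*) [TopologicalSpace M₁] [ChartedSpace H₁ M₁]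
    (M₂ : Type*) [TopologicalSpace M₂] [ChartedSpace H₂ M₂] : Set (M₁ × M₂ → ℝ) :=
  {f | ∃ a : M₁ → ℝ, ContMDiff I₁ 𝓘(ℝ, ℝ) ∞ a ∧ f = a ∘ Prod.fst} ∪
  {f | ∃ b : M₂ → ℝ, ContMDiff I₂ 𝓘(ℝ, ℝ) ∞ b ∧ f = b ∘ Prod.snd}

theorem isGenerating_factorFunctions [FiniteDimensional ℝ E₁] [FiniteDimensional ℝ E₂]
    [I₁.Boundaryless] [I₂.Boundaryless] [IsManifold I₁ ∞ M₁] [IsManifold I₂ ∞ M₂]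
    [T2Space M₁] [T2Space M₂] :
    IsGenerating (I₁.prod I₂) (factorFunctions I₁ I₂ M₁ M₂) where
  smooth := by
    rintro _ (⟨a, ha, rfl⟩ | ⟨b, hb, rfl⟩)
    · exact ha.comp contMDiff_fst
    · exact hb.comp contMDiff_snd
  span p α := by
    obtain ⟨a, ha, ha'⟩ := exists_contMDiff_mvfderiv_eq p.1 (α.comp (tangentInl p))
    obtain ⟨b, hb, hb'⟩ := exists_contMDiff_mvfderiv_eq p.2 (α.comp (tangentInr p))
    have h : α = mvfderiv (I₁.prod I₂) (a ∘ Prod.fst) p +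
        mvfderiv (I₁.prod I₂) (b ∘ Prod.snd) p := by
      ext v
      have h1 := mvfderiv_comp_fst_apply (I₂ := I₂) (mdifferentiableAt_of_contMDiff ha p.1) v
      have h2 := mvfderiv_comp_snd_apply (I₁ := I₁) (mdifferentiableAt_of_contMDiff hb p.2) v
      rw [ha'] at h1
      rw [hb'] at h2
      refine Eq.trans ?_ (congrArg₂ (· + ·) h1 h2).symm
      refine Eq.trans ?_ (α.map_add _ _)
      refine congrArg α ?_
      exact (Prod.fst_add_snd (v : E₁ × E₂)).symm
    rw [h]
    exact Submodule.add_mem _ (Submodule.subset_span ⟨_, Or.inl ⟨a, ha, rfl⟩, rfl⟩)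
      (Submodule.subset_span ⟨_, Or.inr ⟨b, hb, rfl⟩, rfl⟩)

end Product

section Fusion

variable {𝔤 : Type*} [LieRing 𝔤] [LieAlgebra ℝ 𝔤] {t : 𝔤 ⊗[ℝ] 𝔤}
  {E₁ : Type*} [NormedAddCommGroup E₁] [NormedSpace ℝ E₁]
  {H₁ : Type*} [TopologicalSpace H₁] {I₁ : ModelWithCorners ℝ E₁ H₁}
  {M₁ : Type*} [TopologicalSpace M₁] [ChartedSpace H₁ M₁]
  {E₂ : Type*} [NormedAddCommGroup E₂] [NormedSpace ℝ E₂]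
  {H₂ : Type*} [TopologicalSpace H₂] {I₂ : ModelWithCorners ℝ E₂ H₂}
  {M₂ : Type*} [TopologicalSpace M₂] [ChartedSpace H₂ M₂]
  {Q₁ : ActionTensor 𝔤 I₁ M₁} {Q₂ : ActionTensor 𝔤 I₂ M₂}

open ActionTensor

theorem fusion_pi_apply (p : M₁ × M₂) (α β : TangentSpace (I₁.prod I₂) p →L[ℝ] ℝ) :
    (fusion t Q₁ Q₂).π p α β =
      Q₁.π p.1 (α.comp (tangentInl p)) (β.comp (tangentInl p))
        + Q₂.π p.2 (α.comp (tangentInr p)) (β.comp (tangentInr p))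
        - (1 / 2) *
          (tensorEval t (Q₁.coaction p.1 (α.comp (tangentInl p)))
              (Q₂.coaction p.2 (β.comp (tangentInr p)))
            - tensorEval t (Q₂.coaction p.2 (α.comp (tangentInr p)))
              (Q₁.coaction p.1 (β.comp (tangentInl p)))) := rfl

theorem fusion_coaction (p : M₁ × M₂) (α : TangentSpace (I₁.prod I₂) p →L[ℝ] ℝ) :
    (fusion t Q₁ Q₂).coaction p α =
      Q₁.coaction p.1 (α.comp (tangentInl p)) + Q₂.coaction p.2 (α.comp (tangentInr p)) := by
  ext u
  exact α.map_add _ _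

theorem coaction_zero (Q : ActionTensor 𝔤 I₁ M₁) (x : M₁) : Q.coaction x 0 = 0 :=
  (Q.coactionLinear x).map_zero

theorem tensorEval_zero_left (β : Module.Dual ℝ 𝔤) : tensorEval t 0 β = 0 := by
  simp [tensorEval]

theorem tensorEval_zero_right (β : Module.Dual ℝ 𝔤) : tensorEval t β 0 = 0 := by
  simp [tensorEval]

theorem fusion_coaction_fst {a : M₁ → ℝ} (ha : ContMDiff I₁ 𝓘(ℝ, ℝ) ∞ a) (p : M₁ × M₂) :
    (fusion t Q₁ Q₂).coaction p (mvfderiv (I₁.prod I₂) (a ∘ Prod.fst) p) =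
      Q₁.coaction p.1 (mvfderiv I₁ a p.1) := by
  have h := mdifferentiableAt_of_contMDiff ha p.1
  rw [fusion_coaction, mvfderiv_comp_fst_comp_tangentInl h, mvfderiv_comp_fst_comp_tangentInr h,
    coaction_zero, add_zero]

theorem fusion_coaction_snd {b : M₂ → ℝ} (hb : ContMDiff I₂ 𝓘(ℝ, ℝ) ∞ b) (p : M₁ × M₂) :
    (fusion t Q₁ Q₂).coaction p (mvfderiv (I₁.prod I₂) (b ∘ Prod.snd) p) =
      Q₂.coaction p.2 (mvfderiv I₂ b p.2) := by
  have h := mdifferentiableAt_of_contMDiff hb p.2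
  rw [fusion_coaction, mvfderiv_comp_snd_comp_tangentInl h, mvfderiv_comp_snd_comp_tangentInr h,
    coaction_zero, zero_add]

theorem fusion_lieDeriv_fst {a : M₁ → ℝ} (ha : ContMDiff I₁ 𝓘(ℝ, ℝ) ∞ a) (u : 𝔤) :
    (fusion t Q₁ Q₂).lieDeriv u (a ∘ Prod.fst) = Q₁.lieDeriv u a ∘ Prod.fst :=
  funext fun p => DFunLike.congr_fun (fusion_coaction_fst (t := t) ha p) u

theorem fusion_lieDeriv_snd {b : M₂ → ℝ} (hb : ContMDiff I₂ 𝓘(ℝ, ℝ) ∞ b) (u : 𝔤) :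
    (fusion t Q₁ Q₂).lieDeriv u (b ∘ Prod.snd) = Q₂.lieDeriv u b ∘ Prod.snd :=
  funext fun p => DFunLike.congr_fun (fusion_coaction_snd (t := t) hb p) u

theorem fusion_bracket_fst_fst {a a' : M₁ → ℝ} (ha : ContMDiff I₁ 𝓘(ℝ, ℝ) ∞ a)
    (ha' : ContMDiff I₁ 𝓘(ℝ, ℝ) ∞ a') :
    (fusion t Q₁ Q₂).bracket (a ∘ Prod.fst) (a' ∘ Prod.fst) = Q₁.bracket a a' ∘ Prod.fst := by
  funext p
  have h := mdifferentiableAt_of_contMDiff ha p.1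
  have h' := mdifferentiableAt_of_contMDiff ha' p.1
  rw [bracket, fusion_pi_apply, mvfderiv_comp_fst_comp_tangentInl h,
    mvfderiv_comp_fst_comp_tangentInr h, mvfderiv_comp_fst_comp_tangentInl h',
    mvfderiv_comp_fst_comp_tangentInr h', coaction_zero, tensorEval_zero_left,
    tensorEval_zero_right]
  simp [bracket]

theorem fusion_bracket_snd_snd {b b' : M₂ → ℝ} (hb : ContMDiff I₂ 𝓘(ℝ, ℝ) ∞ b)
    (hb' : ContMDiff I₂ 𝓘(ℝ, ℝ) ∞ b') :
    (fusion t Q₁ Q₂).bracket (b ∘ Prod.snd) (b' ∘ Prod.snd) = Q₂.bracket b b' ∘ Prod.snd := by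
  funext p
  have h := mdifferentiableAt_of_contMDiff hb p.2
  have h' := mdifferentiableAt_of_contMDiff hb' p.2
  rw [bracket, fusion_pi_apply, mvfderiv_comp_snd_comp_tangentInl h,
    mvfderiv_comp_snd_comp_tangentInr h, mvfderiv_comp_snd_comp_tangentInl h',
    mvfderiv_comp_snd_comp_tangentInr h', coaction_zero, tensorEval_zero_left,
    tensorEval_zero_right]
  simp [bracket]

theorem fusion_bracket_fst_snd {S : Finset (𝔤 × 𝔤)} (hS : t = ∑ i ∈ S, i.1 ⊗ₜ[ℝ] i.2)
    {a : M₁ → ℝ} {b : M₂ → ℝ} (ha : ContMDiff I₁ 𝓘(ℝ, ℝ) ∞ a) (hb : ContMDiff I₂ 𝓘(ℝ, ℝ) ∞ b) :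
    (fusion t Q₁ Q₂).bracket (a ∘ Prod.fst) (b ∘ Prod.snd) =
      fun p => (-1 / 2) * ∑ i ∈ S, (Q₁.lieDeriv i.1 a ∘ Prod.fst) p *
        (Q₂.lieDeriv i.2 b ∘ Prod.snd) p := by
  funext p
  have h := mdifferentiableAt_of_contMDiff ha p.1
  have h' := mdifferentiableAt_of_contMDiff hb p.2
  rw [bracket, fusion_pi_apply, mvfderiv_comp_fst_comp_tangentInl h,
    mvfderiv_comp_fst_comp_tangentInr h, mvfderiv_comp_snd_comp_tangentInl h',
    mvfderiv_comp_snd_comp_tangentInr h', coaction_zero, coaction_zero, tensorEval_zero_right,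
    tensorEval_eq_sum hS]
  simp [coaction_mvfderiv]
  ring

theorem fusion_skew (ht_symm : TensorProduct.comm ℝ 𝔤 𝔤 t = t)
    (h₁ : ∀ (x : M₁) (α β : TangentSpace I₁ x →L[ℝ] ℝ), Q₁.π x α β = -Q₁.π x β α)
    (h₂ : ∀ (x : M₂) (α β : TangentSpace I₂ x →L[ℝ] ℝ), Q₂.π x α β = -Q₂.π x β α)
    (p : M₁ × M₂) (α β : TangentSpace (I₁.prod I₂) p →L[ℝ] ℝ) :
    (fusion t Q₁ Q₂).π p α β = -(fusion t Q₁ Q₂).π p β α := by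
  rw [fusion_pi_apply, fusion_pi_apply, h₁, h₂,
    tensorEval_swap ht_symm (Q₁.coaction p.1 (α.comp (tangentInl p))),
    tensorEval_swap ht_symm (Q₂.coaction p.2 (α.comp (tangentInr p)))]
  ring

theorem fusion_bracket_snd_fst (ht_symm : TensorProduct.comm ℝ 𝔤 𝔤 t = t)
    (h₁ : ∀ (x : M₁) (α β : TangentSpace I₁ x →L[ℝ] ℝ), Q₁.π x α β = -Q₁.π x β α)
    (h₂ : ∀ (x : M₂) (α β : TangentSpace I₂ x →L[ℝ] ℝ), Q₂.π x α β = -Q₂.π x β α)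
    {S : Finset (𝔤 × 𝔤)} (hS : t = ∑ i ∈ S, i.1 ⊗ₜ[ℝ] i.2)
    {a : M₁ → ℝ} {b : M₂ → ℝ} (ha : ContMDiff I₁ 𝓘(ℝ, ℝ) ∞ a) (hb : ContMDiff I₂ 𝓘(ℝ, ℝ) ∞ b) :
    (fusion t Q₁ Q₂).bracket (b ∘ Prod.snd) (a ∘ Prod.fst) =
      fun p => (1 / 2) * ∑ i ∈ S, (Q₁.lieDeriv i.1 a ∘ Prod.fst) p *
        (Q₂.lieDeriv i.2 b ∘ Prod.snd) p := by
  rw [bracket_swap (fusion_skew ht_symm h₁ h₂), fusion_bracket_fst_snd hS ha hb]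
  funext p
  simp only [Pi.neg_apply]
  ring

variable [I₁.Boundaryless] [I₂.Boundaryless] [IsManifold I₁ ∞ M₁] [IsManifold I₂ ∞ M₂]

/-- Invariance of the tensor `t`, on pairs of functions. -/
theorem sum_lieDeriv_lie_eq_zero (ht_inv : ∀ u : 𝔤, ⁅u, t⁆ = 0) (hQ₁ : Q₁.IsQuasiPoisson t)
    (hQ₂ : Q₂.IsQuasiPoisson t) {S : Finset (𝔤 × 𝔤)} (hS : t = ∑ i ∈ S, i.1 ⊗ₜ[ℝ] i.2)
    {a : M₁ → ℝ} {b : M₂ → ℝ} (ha : ContMDiff I₁ 𝓘(ℝ, ℝ) ∞ a) (hb : ContMDiff I₂ 𝓘(ℝ, ℝ) ∞ b)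
    (u : 𝔤) (x : M₁) (y : M₂) :
    ∑ i ∈ S, (Q₁.lieDeriv u (Q₁.lieDeriv i.1 a) x * Q₂.lieDeriv i.2 b y
      + Q₁.lieDeriv i.1 a x * Q₂.lieDeriv u (Q₂.lieDeriv i.2 b) y) =
    ∑ i ∈ S, (Q₁.lieDeriv i.1 (Q₁.lieDeriv u a) x * Q₂.lieDeriv i.2 b y
      + Q₁.lieDeriv i.1 a x * Q₂.lieDeriv i.2 (Q₂.lieDeriv u b) y) := by
  have h := tensorEval_ad ht_inv u (Q₁.coaction x (mvfderiv I₁ a x))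
    (Q₂.coaction y (mvfderiv I₂ b y))
  rw [tensorEval_eq_sum hS, tensorEval_eq_sum hS, ← Finset.sum_add_distrib] at h
  rw [← sub_eq_zero, ← Finset.sum_sub_distrib, ← h]
  refine Finset.sum_congr rfl fun i _ => ?_
  simp only [LinearMap.comp_apply, LieModule.toEnd_apply_apply, coaction_mvfderiv,
    hQ₁.lieDeriv_lie _ _ ha, hQ₂.lieDeriv_lie _ _ hb]
  ring

theorem fusion_halfSchouten_fst_fst_snd (ht_symm : TensorProduct.comm ℝ 𝔤 𝔤 t = t)
    (hQ₁ : Q₁.IsQuasiPoisson t) (hQ₂ : Q₂.IsQuasiPoisson t)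
    {a a' : M₁ → ℝ} {b : M₂ → ℝ} (ha : ContMDiff I₁ 𝓘(ℝ, ℝ) ∞ a)
    (ha' : ContMDiff I₁ 𝓘(ℝ, ℝ) ∞ a') (hb : ContMDiff I₂ 𝓘(ℝ, ℝ) ∞ b) (p : M₁ × M₂) :
    (fusion t Q₁ Q₂).halfSchouten (a ∘ Prod.fst) (a' ∘ Prod.fst) (b ∘ Prod.snd) p =
      phi t (Q₁.coaction p.1 (mvfderiv I₁ a p.1)) (Q₁.coaction p.1 (mvfderiv I₁ a' p.1))
        (Q₂.coaction p.2 (mvfderiv I₂ b p.2)) := by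
  obtain ⟨S, hS⟩ := TensorProduct.exists_finset t
  have hL₁ : ∀ {f : M₁ → ℝ}, ContMDiff I₁ 𝓘(ℝ, ℝ) ∞ f → ∀ i : 𝔤 × 𝔤,
      ContMDiff (I₁.prod I₂) 𝓘(ℝ, ℝ) ∞ (Q₁.lieDeriv i.1 f ∘ (Prod.fst : M₁ × M₂ → M₁)) :=
    fun hf i => (hQ₁.contMDiff_lieDeriv i.1 hf).comp contMDiff_fst
  have hL₂ : ∀ i : 𝔤 × 𝔤,
      ContMDiff (I₁.prod I₂) 𝓘(ℝ, ℝ) ∞ (Q₂.lieDeriv i.2 b ∘ (Prod.snd : M₁ × M₂ → M₂)) :=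
    fun i => (hQ₂.contMDiff_lieDeriv i.2 hb).comp contMDiff_snd
  have hab := hQ₁.smooth_bivector a a' ha ha'
  rw [halfSchouten, fusion_bracket_fst_snd hS ha' hb,
    fusion_bracket_snd_fst ht_symm hQ₁.skew hQ₂.skew hS ha hb, fusion_bracket_fst_fst ha ha',
    bracket_const_mul_sum_mul _ _ _ (hL₁ ha') hL₂, bracket_const_mul_sum_mul _ _ _ (hL₁ ha) hL₂,
    fusion_bracket_snd_fst ht_symm hQ₁.skew hQ₂.skew hS hab hb]
  simp only [fusion_bracket_fst_fst ha (hQ₁.contMDiff_lieDeriv _ ha'),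
    fusion_bracket_fst_fst ha' (hQ₁.contMDiff_lieDeriv _ ha),
    fusion_bracket_fst_snd hS ha (hQ₂.contMDiff_lieDeriv _ hb),
    fusion_bracket_fst_snd hS ha' (hQ₂.contMDiff_lieDeriv _ hb), Function.comp_apply,
    hQ₁.invariant _ a a' ha ha']
  have hR : phi t (Q₁.coaction p.1 (mvfderiv I₁ a p.1)) (Q₁.coaction p.1 (mvfderiv I₁ a' p.1))
        (Q₂.coaction p.2 (mvfderiv I₂ b p.2)) =
      (1 / 4) * ∑ i ∈ S, ∑ j ∈ S, (Q₁.lieDeriv j.1 a p.1 * Q₁.lieDeriv i.1 a' p.1 *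
        (Q₂.lieDeriv j.2 (Q₂.lieDeriv i.2 b) p.2 - Q₂.lieDeriv i.2 (Q₂.lieDeriv j.2 b) p.2)) := by
    rw [phi, sharp_eq_sum hS, sharp_eq_sum hS]
    simp only [lie_sum, sum_lie, smul_lie, lie_smul, map_sum, map_smul, coaction_mvfderiv,
      smul_eq_mul, hQ₂.lieDeriv_lie _ _ hb]
    congr 1
    refine Finset.sum_congr rfl fun i _ => ?_
    rw [Finset.mul_sum]
    exact Finset.sum_congr rfl fun j _ => by ring
  have hA : ∀ i : 𝔤 × 𝔤, Q₁.bracket a' (Q₁.lieDeriv i.1 a) p.1 =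
      -Q₁.bracket (Q₁.lieDeriv i.1 a) a' p.1 := fun i => hQ₁.skew _ _ _
  have hR2 : ∑ i ∈ S, ∑ j ∈ S, (Q₁.lieDeriv j.1 a p.1 * Q₁.lieDeriv i.1 a' p.1 *
        (Q₂.lieDeriv j.2 (Q₂.lieDeriv i.2 b) p.2 - Q₂.lieDeriv i.2 (Q₂.lieDeriv j.2 b) p.2)) =
      ∑ i ∈ S, (Q₁.lieDeriv i.1 a' p.1 * ∑ j ∈ S, Q₁.lieDeriv j.1 a p.1 *
          Q₂.lieDeriv j.2 (Q₂.lieDeriv i.2 b) p.2) -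
      ∑ i ∈ S, (Q₁.lieDeriv i.1 a p.1 * ∑ j ∈ S, Q₁.lieDeriv j.1 a' p.1 *
          Q₂.lieDeriv j.2 (Q₂.lieDeriv i.2 b) p.2) := by
    simp only [mul_sub, Finset.sum_sub_distrib, Finset.mul_sum]
    congr 1
    · exact Finset.sum_congr rfl fun i _ => Finset.sum_congr rfl fun j _ => by ring
    · rw [Finset.sum_comm]
      exact Finset.sum_congr rfl fun i _ => Finset.sum_congr rfl fun j _ => by ring
  rw [hR, hR2]
  simp only [hA]
  rw [← Finset.sum_sub_distrib, Finset.mul_sum, Finset.mul_sum, Finset.mul_sum, Finset.mul_sum,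
    ← Finset.sum_add_distrib, ← Finset.sum_add_distrib]
  exact Finset.sum_congr rfl fun i _ => by ring

theorem fusion_halfSchouten_snd_snd_fst (ht_symm : TensorProduct.comm ℝ 𝔤 𝔤 t = t)
    (hQ₁ : Q₁.IsQuasiPoisson t) (hQ₂ : Q₂.IsQuasiPoisson t)
    {a : M₁ → ℝ} {b b' : M₂ → ℝ} (ha : ContMDiff I₁ 𝓘(ℝ, ℝ) ∞ a)
    (hb : ContMDiff I₂ 𝓘(ℝ, ℝ) ∞ b) (hb' : ContMDiff I₂ 𝓘(ℝ, ℝ) ∞ b') (p : M₁ × M₂) :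
    (fusion t Q₁ Q₂).halfSchouten (b ∘ Prod.snd) (b' ∘ Prod.snd) (a ∘ Prod.fst) p =
      phi t (Q₂.coaction p.2 (mvfderiv I₂ b p.2)) (Q₂.coaction p.2 (mvfderiv I₂ b' p.2))
        (Q₁.coaction p.1 (mvfderiv I₁ a p.1)) := by
  obtain ⟨S, hS⟩ := TensorProduct.exists_finset t
  have hL₂ : ∀ {f : M₂ → ℝ}, ContMDiff I₂ 𝓘(ℝ, ℝ) ∞ f → ∀ i : 𝔤 × 𝔤,
      ContMDiff (I₁.prod I₂) 𝓘(ℝ, ℝ) ∞ (Q₂.lieDeriv i.2 f ∘ (Prod.snd : M₁ × M₂ → M₂)) :=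
    fun hf i => (hQ₂.contMDiff_lieDeriv i.2 hf).comp contMDiff_snd
  have hL₁ : ∀ i : 𝔤 × 𝔤,
      ContMDiff (I₁.prod I₂) 𝓘(ℝ, ℝ) ∞ (Q₁.lieDeriv i.1 a ∘ (Prod.fst : M₁ × M₂ → M₁)) :=
    fun i => (hQ₁.contMDiff_lieDeriv i.1 ha).comp contMDiff_fst
  have hbb := hQ₂.smooth_bivector b b' hb hb'
  rw [halfSchouten, fusion_bracket_snd_fst ht_symm hQ₁.skew hQ₂.skew hS ha hb',
    fusion_bracket_fst_snd hS ha hb, fusion_bracket_snd_snd hb hb',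
    bracket_const_mul_sum_mul _ _ _ hL₁ (hL₂ hb'), bracket_const_mul_sum_mul _ _ _ hL₁ (hL₂ hb),
    fusion_bracket_fst_snd hS ha hbb]
  simp only [fusion_bracket_snd_snd hb (hQ₂.contMDiff_lieDeriv _ hb'),
    fusion_bracket_snd_snd hb' (hQ₂.contMDiff_lieDeriv _ hb),
    fusion_bracket_snd_fst ht_symm hQ₁.skew hQ₂.skew hS (hQ₁.contMDiff_lieDeriv _ ha) hb,
    fusion_bracket_snd_fst ht_symm hQ₁.skew hQ₂.skew hS (hQ₁.contMDiff_lieDeriv _ ha) hb',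
    Function.comp_apply, hQ₂.invariant _ b b' hb hb']
  have hR : phi t (Q₂.coaction p.2 (mvfderiv I₂ b p.2)) (Q₂.coaction p.2 (mvfderiv I₂ b' p.2))
        (Q₁.coaction p.1 (mvfderiv I₁ a p.1)) =
      (1 / 4) * ∑ i ∈ S, ∑ j ∈ S, (Q₂.lieDeriv j.2 b p.2 * Q₂.lieDeriv i.2 b' p.2 *
        (Q₁.lieDeriv j.1 (Q₁.lieDeriv i.1 a) p.1 - Q₁.lieDeriv i.1 (Q₁.lieDeriv j.1 a) p.1)) := by
    rw [phi, sharp_eq_sum_swap ht_symm hS, sharp_eq_sum_swap ht_symm hS]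
    simp only [lie_sum, sum_lie, smul_lie, lie_smul, map_sum, map_smul, coaction_mvfderiv,
      smul_eq_mul, hQ₁.lieDeriv_lie _ _ ha]
    congr 1
    refine Finset.sum_congr rfl fun i _ => ?_
    rw [Finset.mul_sum]
    exact Finset.sum_congr rfl fun j _ => by ring
  have hB : ∀ i : 𝔤 × 𝔤, Q₂.bracket b' (Q₂.lieDeriv i.2 b) p.2 =
      -Q₂.bracket (Q₂.lieDeriv i.2 b) b' p.2 := fun i => hQ₂.skew _ _ _
  have hR2 : ∑ i ∈ S, ∑ j ∈ S, (Q₂.lieDeriv j.2 b p.2 * Q₂.lieDeriv i.2 b' p.2 *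
        (Q₁.lieDeriv j.1 (Q₁.lieDeriv i.1 a) p.1 - Q₁.lieDeriv i.1 (Q₁.lieDeriv j.1 a) p.1)) =
      ∑ i ∈ S, (Q₂.lieDeriv i.2 b' p.2 * ∑ j ∈ S,
          Q₁.lieDeriv j.1 (Q₁.lieDeriv i.1 a) p.1 * Q₂.lieDeriv j.2 b p.2) -
      ∑ i ∈ S, (Q₂.lieDeriv i.2 b p.2 * ∑ j ∈ S,
          Q₁.lieDeriv j.1 (Q₁.lieDeriv i.1 a) p.1 * Q₂.lieDeriv j.2 b' p.2) := by
    simp only [mul_sub, Finset.sum_sub_distrib, Finset.mul_sum]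
    congr 1
    · exact Finset.sum_congr rfl fun i _ => Finset.sum_congr rfl fun j _ => by ring
    · rw [Finset.sum_comm]
      exact Finset.sum_congr rfl fun i _ => Finset.sum_congr rfl fun j _ => by ring
  rw [hR, hR2]
  simp only [hB]
  rw [← Finset.sum_sub_distrib, Finset.mul_sum, Finset.mul_sum, Finset.mul_sum, Finset.mul_sum,
    ← Finset.sum_add_distrib, ← Finset.sum_add_distrib]
  exact Finset.sum_congr rfl fun i _ => by ring

theorem fusion_invariant_fst_snd (ht_inv : ∀ u : 𝔤, ⁅u, t⁆ = 0)
    (hQ₁ : Q₁.IsQuasiPoisson t) (hQ₂ : Q₂.IsQuasiPoisson t)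
    {a : M₁ → ℝ} {b : M₂ → ℝ} (ha : ContMDiff I₁ 𝓘(ℝ, ℝ) ∞ a)
    (hb : ContMDiff I₂ 𝓘(ℝ, ℝ) ∞ b) (u : 𝔤) (p : M₁ × M₂) :
    (fusion t Q₁ Q₂).lieDeriv u ((fusion t Q₁ Q₂).bracket (a ∘ Prod.fst) (b ∘ Prod.snd)) p =
      (fusion t Q₁ Q₂).bracket ((fusion t Q₁ Q₂).lieDeriv u (a ∘ Prod.fst)) (b ∘ Prod.snd) p
      + (fusion t Q₁ Q₂).bracket (a ∘ Prod.fst) ((fusion t Q₁ Q₂).lieDeriv u (b ∘ Prod.snd)) p := by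
  obtain ⟨S, hS⟩ := TensorProduct.exists_finset t
  have hL₁ := fun i : 𝔤 × 𝔤 => hQ₁.contMDiff_lieDeriv i.1 ha
  have hL₂ := fun i : 𝔤 × 𝔤 => hQ₂.contMDiff_lieDeriv i.2 hb
  rw [fusion_lieDeriv_fst ha, fusion_lieDeriv_snd hb, fusion_bracket_fst_snd hS ha hb,
    fusion_bracket_fst_snd hS (hQ₁.contMDiff_lieDeriv u ha) hb,
    fusion_bracket_fst_snd hS ha (hQ₂.contMDiff_lieDeriv u hb),
    lieDeriv_const_mul_sum_mul _ _ _ (fun i => (hL₁ i).comp contMDiff_fst)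
      (fun i => (hL₂ i).comp contMDiff_snd)]
  have h := sum_lieDeriv_lie_eq_zero ht_inv hQ₁ hQ₂ hS ha hb u p.1 p.2
  simp only [fusion_lieDeriv_fst (hL₁ _), fusion_lieDeriv_snd (hL₂ _), Function.comp_apply]
  rw [← mul_add, ← Finset.sum_add_distrib, ← h]
  congr 1
  exact Finset.sum_congr rfl fun i _ => by ring

omit [I₁.Boundaryless] [IsManifold I₁ ∞ M₁] in
theorem halfSchouten_cyclic (Q : ActionTensor 𝔤 I₁ M₁) (f g h : M₁ → ℝ) (x : M₁) :
    Q.halfSchouten f g h x = Q.halfSchouten g h f x := by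
  rw [halfSchouten, halfSchouten]
  ring

/-- The fusion product of quasi-Poisson manifolds is quasi-Poisson. -/
theorem isQuasiPoisson_fusion [FiniteDimensional ℝ E₁] [FiniteDimensional ℝ E₂]
    [T2Space M₁] [T2Space M₂] (ht_symm : TensorProduct.comm ℝ 𝔤 𝔤 t = t)
    (ht_inv : ∀ u : 𝔤, ⁅u, t⁆ = 0)
    (hQ₁ : Q₁.IsQuasiPoisson t) (hQ₂ : Q₂.IsQuasiPoisson t) :
    (fusion t Q₁ Q₂).IsQuasiPoisson t := by
  have skew := fusion_skew (t := t) ht_symm hQ₁.skew hQ₂.skew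
  refine IsQuasiPoisson.of_isGenerating ht_symm ht_inv isGenerating_factorFunctions
    ?_ ?_ skew ?_ ?_ ?_
  · rintro u _ (⟨a, ha, rfl⟩ | ⟨b, hb, rfl⟩)
    · rw [fusion_lieDeriv_fst ha]
      exact (hQ₁.contMDiff_lieDeriv u ha).comp contMDiff_fst
    · rw [fusion_lieDeriv_snd hb]
      exact (hQ₂.contMDiff_lieDeriv u hb).comp contMDiff_snd
  · rintro u v _ (⟨a, ha, rfl⟩ | ⟨b, hb, rfl⟩) p
    · rw [fusion_lieDeriv_fst ha, fusion_lieDeriv_fst ha, fusion_lieDeriv_fst ha,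
        fusion_lieDeriv_fst (hQ₁.contMDiff_lieDeriv _ ha),
        fusion_lieDeriv_fst (hQ₁.contMDiff_lieDeriv _ ha)]
      exact hQ₁.lieDeriv_lie u v ha p.1
    · rw [fusion_lieDeriv_snd hb, fusion_lieDeriv_snd hb, fusion_lieDeriv_snd hb,
        fusion_lieDeriv_snd (hQ₂.contMDiff_lieDeriv _ hb),
        fusion_lieDeriv_snd (hQ₂.contMDiff_lieDeriv _ hb)]
      exact hQ₂.lieDeriv_lie u v hb p.2
  · have hfs : ∀ {a : M₁ → ℝ} {b : M₂ → ℝ}, ContMDiff I₁ 𝓘(ℝ, ℝ) ∞ a → ContMDiff I₂ 𝓘(ℝ, ℝ) ∞ b →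
        ContMDiff (I₁.prod I₂) 𝓘(ℝ, ℝ) ∞
          ((fusion t Q₁ Q₂).bracket (a ∘ Prod.fst) (b ∘ Prod.snd)) := by
      intro a b ha hb
      obtain ⟨S, hS⟩ := TensorProduct.exists_finset t
      rw [fusion_bracket_fst_snd hS ha hb]
      exact contMDiff_const.mul (contMDiff_finsetSum fun i _ =>
        ((hQ₁.contMDiff_lieDeriv i.1 ha).comp contMDiff_fst).mul
          ((hQ₂.contMDiff_lieDeriv i.2 hb).comp contMDiff_snd))
    rintro _ (⟨a, ha, rfl⟩ | ⟨b, hb, rfl⟩) _ (⟨a', ha', rfl⟩ | ⟨b', hb', rfl⟩)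
    · rw [fusion_bracket_fst_fst ha ha']
      exact (hQ₁.smooth_bivector a a' ha ha').comp contMDiff_fst
    · exact hfs ha hb'
    · rw [bracket_swap skew]
      exact (hfs ha' hb).neg
    · rw [fusion_bracket_snd_snd hb hb']
      exact (hQ₂.smooth_bivector b b' hb hb').comp contMDiff_snd
  · rintro u _ (⟨a, ha, rfl⟩ | ⟨b, hb, rfl⟩) _ (⟨a', ha', rfl⟩ | ⟨b', hb', rfl⟩) p
    · rw [fusion_bracket_fst_fst ha ha', fusion_lieDeriv_fst (hQ₁.smooth_bivector a a' ha ha'),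
        fusion_lieDeriv_fst ha, fusion_lieDeriv_fst ha',
        fusion_bracket_fst_fst (hQ₁.contMDiff_lieDeriv u ha) ha',
        fusion_bracket_fst_fst ha (hQ₁.contMDiff_lieDeriv u ha')]
      exact hQ₁.invariant u a a' ha ha' p.1
    · exact fusion_invariant_fst_snd ht_inv hQ₁ hQ₂ ha hb' u p
    · have h := fusion_invariant_fst_snd ht_inv hQ₁ hQ₂ ha' hb u p
      rw [bracket_swap skew, lieDeriv_neg, h, bracket_swap skew _ (a' ∘ Prod.fst),
        bracket_swap skew (b ∘ Prod.snd)]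
      simp only [Pi.neg_apply]
      ring
    · rw [fusion_bracket_snd_snd hb hb', fusion_lieDeriv_snd (hQ₂.smooth_bivector b b' hb hb'),
        fusion_lieDeriv_snd hb, fusion_lieDeriv_snd hb',
        fusion_bracket_snd_snd (hQ₂.contMDiff_lieDeriv u hb) hb',
        fusion_bracket_snd_snd hb (hQ₂.contMDiff_lieDeriv u hb')]
      exact hQ₂.invariant u b b' hb hb' p.2
  · have hcyc := halfSchouten_cyclic (Q := fusion t Q₁ Q₂)
    clear skew
    rintro _ (⟨a, ha, rfl⟩ | ⟨b, hb, rfl⟩) _ (⟨a', ha', rfl⟩ | ⟨b', hb', rfl⟩)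
      _ (⟨a'', ha'', rfl⟩ | ⟨b'', hb'', rfl⟩) p
    all_goals simp (discharger := assumption) only [fusion_coaction_fst, fusion_coaction_snd]
    · rw [halfSchouten, fusion_bracket_fst_fst ha ha', fusion_bracket_fst_fst ha' ha'',
        fusion_bracket_fst_fst ha'' ha,
        fusion_bracket_fst_fst ha (hQ₁.smooth_bivector _ _ ha' ha''),
        fusion_bracket_fst_fst ha' (hQ₁.smooth_bivector _ _ ha'' ha),
        fusion_bracket_fst_fst ha'' (hQ₁.smooth_bivector _ _ ha ha')]
      exact hQ₁.schouten a a' a'' ha ha' ha'' p.1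
    · exact fusion_halfSchouten_fst_fst_snd ht_symm hQ₁ hQ₂ ha ha' hb'' p
    · rw [hcyc, hcyc, phi_cyclic ht_symm ht_inv, phi_cyclic ht_symm ht_inv]
      exact fusion_halfSchouten_fst_fst_snd ht_symm hQ₁ hQ₂ ha'' ha hb' p
    · rw [hcyc, phi_cyclic ht_symm ht_inv]
      exact fusion_halfSchouten_snd_snd_fst ht_symm hQ₁ hQ₂ ha hb' hb'' p
    · rw [hcyc, phi_cyclic ht_symm ht_inv]
      exact fusion_halfSchouten_fst_fst_snd ht_symm hQ₁ hQ₂ ha' ha'' hb p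
    · rw [hcyc, hcyc, phi_cyclic ht_symm ht_inv, phi_cyclic ht_symm ht_inv]
      exact fusion_halfSchouten_snd_snd_fst ht_symm hQ₁ hQ₂ ha' hb'' hb p
    · exact fusion_halfSchouten_snd_snd_fst ht_symm hQ₁ hQ₂ ha'' hb hb' p
    · rw [halfSchouten, fusion_bracket_snd_snd hb hb', fusion_bracket_snd_snd hb' hb'',
        fusion_bracket_snd_snd hb'' hb,
        fusion_bracket_snd_snd hb (hQ₂.smooth_bivector _ _ hb' hb''),
        fusion_bracket_snd_snd hb' (hQ₂.smooth_bivector _ _ hb'' hb),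
        fusion_bracket_snd_snd hb'' (hQ₂.smooth_bivector _ _ hb hb')]
      exact hQ₂.schouten b b' b'' hb hb' hb'' p.2

end Fusion

section InverseFunction

variable {E : Type*} [NormedAddCommGroup E] [NormedSpace ℝ E] [FiniteDimensional ℝ E]
  {F : Type*} [NormedAddCommGroup F] [NormedSpace ℝ F] [FiniteDimensional ℝ F]

/-- The inverse function theorem for smooth maps on an open set. -/
theorem exists_openPartialHomeomorph_of_hasFDerivAt {G : Type*} [NormedAddCommGroup G]
    [NormedSpace ℝ G] {Φ : E → G} {Ω : Set E} (hΩ : IsOpen Ω) (hΦ : ContDiffOn ℝ ∞ Φ Ω) {z : E}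
    (hz : z ∈ Ω) {T : E ≃L[ℝ] G} (hT : HasFDerivAt Φ (T : E →L[ℝ] G) z) :
    ∃ φ : OpenPartialHomeomorph E G, z ∈ φ.source ∧ φ.source ⊆ Ω ∧ ⇑φ = Φ ∧
      ContDiffOn ℝ ∞ φ.symm φ.target := by
  have hΦz : ContDiffAt ℝ ∞ Φ z := hΦ.contDiffAt (hΩ.mem_nhds hz)
  let φ₀ := hΦz.toOpenPartialHomeomorph Φ hT (by simp)
  let U : Set E := Ω ∩ fderiv ℝ Φ ⁻¹' Set.range ((↑) : (E ≃L[ℝ] G) → E →L[ℝ] G)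
  have hU : IsOpen U :=
    (hΦ.continuousOn_fderiv_of_isOpen hΩ (by simp)).isOpen_inter_preimage hΩ
      ContinuousLinearEquiv.isOpen
  refine ⟨φ₀.restrOpen U hU, ?_, ?_, rfl, ?_⟩
  · exact ⟨hΦz.mem_toOpenPartialHomeomorph_source hT (by simp), hz, T, hT.fderiv.symm⟩
  · exact fun w hw => hw.2.1
  · intro w hw
    refine ContDiffAt.contDiffWithinAt ?_
    have hs : (φ₀.restrOpen U hU).symm w ∈ (φ₀.restrOpen U hU).source :=
      (φ₀.restrOpen U hU).map_target hw
    obtain ⟨T', hT'⟩ := hs.2.2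
    have hd : ContDiffAt ℝ ∞ Φ ((φ₀.restrOpen U hU).symm w) :=
      hΦ.contDiffAt (hΩ.mem_nhds hs.2.1)
    refine (φ₀.restrOpen U hU).contDiffAt_symm (f₀' := T') hw ?_ hd
    rw [hT']
    exact (hd.differentiableAt (by simp)).hasFDerivAt

theorem exists_continuousLinearEquiv_prod {D : E →L[ℝ] F} (hD : Function.Surjective D) {k : ℕ}
    (hk : k + Module.finrank ℝ F = Module.finrank ℝ E) :
    ∃ (A : E →L[ℝ] EuclideanSpace ℝ (Fin k)) (T : E ≃L[ℝ] EuclideanSpace ℝ (Fin k) × F),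
      (T : E →L[ℝ] EuclideanSpace ℝ (Fin k) × F) = A.prod D := by
  have hker : Module.finrank ℝ (LinearMap.ker D.toLinearMap) = k := by
    have h1 := LinearMap.finrank_range_add_finrank_ker D.toLinearMap
    rw [LinearMap.range_eq_top.2 hD, finrank_top] at h1
    omega
  let κ : LinearMap.ker D.toLinearMap ≃ₗ[ℝ] EuclideanSpace ℝ (Fin k) :=
    LinearEquiv.ofFinrankEq _ _ (by simp [hker])
  obtain ⟨r, hr⟩ := LinearMap.exists_leftInverse_of_injective
    (LinearMap.ker D.toLinearMap).subtype (Submodule.ker_subtype _)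
  let A : E →L[ℝ] EuclideanSpace ℝ (Fin k) := LinearMap.toContinuousLinearMap (κ.toLinearMap ∘ₗ r)
  have hinj : Function.Injective (A.prod D).toLinearMap := by
    rw [← LinearMap.ker_eq_bot, LinearMap.ker_eq_bot']
    intro v hv
    have hv1 : κ (r v) = 0 := congrArg Prod.fst hv
    have hv2 : D v = 0 := congrArg Prod.snd hv
    have hrv : r v = ⟨v, hv2⟩ := DFunLike.congr_fun hr (⟨v, hv2⟩ : LinearMap.ker D.toLinearMap)
    have : r v = 0 := by simpa using hv1
    rw [hrv] at this
    exact congrArg Subtype.val this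
  have hfin : Module.finrank ℝ E = Module.finrank ℝ (EuclideanSpace ℝ (Fin k) × F) := by
    rw [Module.finrank_prod, finrank_euclideanSpace_fin, hk]
  refine ⟨A, (LinearEquiv.ofInjectiveOfFinrankEq (A.prod D).toLinearMap hinj
    hfin).toContinuousLinearEquiv, ?_⟩
  ext v <;> rfl

end InverseFunction

section Slice

variable {E : Type*} [NormedAddCommGroup E] [NormedSpace ℝ E]
  {H : Type*} [TopologicalSpace H] {I : ModelWithCorners ℝ E H}
  {M : Type*} [TopologicalSpace M] [ChartedSpace H M]
  {V : Type*} [NormedAddCommGroup V] [NormedSpace ℝ V]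
  {F : Type*} [NormedAddCommGroup F] [NormedSpace ℝ F]

/-- A diffeomorphism of an open set with an open subset of `V × F` which maps `S` to `V × 0`. -/
structure IsSliceChart (I : ModelWithCorners ℝ E H) (S : Set M)
    (χ : OpenPartialHomeomorph M (V × F)) : Prop where
  contMDiffOn : ContMDiffOn I 𝓘(ℝ, V × F) ∞ χ χ.source
  contMDiffOn_symm : ContMDiffOn 𝓘(ℝ, V × F) I ∞ χ.symm χ.target
  mem_iff : ∀ q ∈ χ.source, q ∈ S ↔ (χ q).2 = 0

/-- The preimage of a regular value has slice charts. -/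
theorem exists_isSliceChart [FiniteDimensional ℝ E] [FiniteDimensional ℝ F] [I.Boundaryless]
    [IsManifold I ∞ M] {S U : Set M} (hU : IsOpen U) {L : M → F}
    (hL : ContMDiffOn I 𝓘(ℝ, F) ∞ L U) (hS : ∀ q ∈ U, q ∈ S ↔ L q = 0) {p : M} (hp : p ∈ U)
    (hD : Function.Surjective (mfderiv I 𝓘(ℝ, F) L p)) {k : ℕ}
    (hk : k + Module.finrank ℝ F = Module.finrank ℝ E) :
    ∃ χ : OpenPartialHomeomorph M (EuclideanSpace ℝ (Fin k) × F),
      p ∈ χ.source ∧ IsSliceChart I S χ := by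
  let e := extChartAt I p
  let Ω : Set E := e.target ∩ e.symm ⁻¹' U
  have hΩ : IsOpen Ω :=
    (continuousOn_extChartAt_symm p).isOpen_inter_preimage (isOpen_extChartAt_target p) hU
  have hpΩ : e p ∈ Ω := ⟨mem_extChartAt_target p, by
    simpa only [Set.mem_preimage, e, extChartAt_to_inv] using hp⟩
  have hg : ContDiffOn ℝ ∞ (L ∘ e.symm) Ω := by
    rw [← contMDiffOn_iff_contDiffOn]
    exact hL.comp ((contMDiffOn_extChartAt_symm p).mono Set.inter_subset_left) fun z hz => hz.2
  have hLp : MDifferentiableAt I 𝓘(ℝ, F) L p :=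
    (hL.contMDiffAt (hU.mem_nhds hp)).mdifferentiableAt (by simp)
  have hD' : Function.Surjective (fderiv ℝ (L ∘ e.symm) (e p)) := by
    have h := hLp.mfderiv
    rw [I.range_eq_univ, fderivWithin_univ] at h
    have h2 : Function.Surjective
        (fderiv ℝ (writtenInExtChartAt I 𝓘(ℝ, F) p L) (extChartAt I p p)) := by
      rw [← h]; exact hD
    exact h2
  obtain ⟨A, T, hT⟩ := exists_continuousLinearEquiv_prod hD' hk
  have hgp : HasFDerivAt (L ∘ e.symm) (fderiv ℝ (L ∘ e.symm) (e p)) (e p) :=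
    ((hg.contDiffAt (hΩ.mem_nhds hpΩ)).differentiableAt (by simp)).hasFDerivAt
  obtain ⟨φ, hφp, hφΩ, hφ, hφs⟩ := exists_openPartialHomeomorph_of_hasFDerivAt
    (Φ := fun z => (A z, (L ∘ e.symm) z)) hΩ (A.contDiff.contDiffOn.prodMk hg) hpΩ
    (T := T) (by rw [hT]; exact A.hasFDerivAt.prodMk hgp)
  let χ := ((chartAt H p).trans I.toHomeomorph.toOpenPartialHomeomorph).trans φ
  have hχs : ∀ q, q ∈ χ.source ↔ q ∈ e.source ∧ e q ∈ φ.source := by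
    intro q
    simp [χ, e]
  have hχt : ∀ w, w ∈ χ.target ↔ w ∈ φ.target ∧ φ.symm w ∈ e.target := by
    intro w
    simp only [χ, e, mfld_simps, I.range_eq_univ]
    simp
  refine ⟨χ, (hχs p).2 ⟨mem_extChartAt_source p, hφp⟩, ?_, ?_, ?_⟩
  · have h1 : ContDiffOn ℝ ∞ φ φ.source := by
      rw [hφ]; exact (A.contDiff.contDiffOn.prodMk hg).mono hφΩ
    exact h1.contMDiffOn.comp ((contMDiffOn_extChartAt (I := I) (x := p)).mono fun q hq => by
      rw [← extChartAt_source (I := I)]; exact ((hχs q).1 hq).1) fun q hq => ((hχs q).1 hq).2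
  · exact (contMDiffOn_extChartAt_symm p).comp (hφs.contMDiffOn.mono fun w hw => ((hχt w).1 hw).1)
      fun w hw => ((hχt w).1 hw).2
  · intro q hq
    obtain ⟨hq1, hq2⟩ := (hχs q).1 hq
    have h1 : e.symm (e q) = q := e.left_inv hq1
    have hqU : q ∈ U := by
      have := (hφΩ hq2).2
      rwa [Set.mem_preimage, h1] at this
    have h2 : (χ q).2 = L q := by
      change (φ (e q)).2 = L q
      rw [hφ]
      simp [h1]
    rw [h2]
    exact hS q hqU

variable {S : Set M}

open Classical in
/-- The chart of `S` given by a slice chart of the ambient manifold. -/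
def sliceChart (χ : OpenPartialHomeomorph M (V × F)) (hχ : IsSliceChart I S χ) (p : S) :
    OpenPartialHomeomorph S V where
  toFun q := (χ q).1
  invFun u := if h : χ.symm (u, 0) ∈ S then ⟨χ.symm (u, 0), h⟩ else p
  source := Subtype.val ⁻¹' χ.source
  target := {u | (u, (0 : F)) ∈ χ.target}
  map_source' q hq := by
    have h := χ.map_source hq
    rwa [← Prod.mk.eta (p := χ q), (hχ.mem_iff q hq).1 q.2] at h
  map_target' u hu := by
    have h := χ.map_target hu
    have hS : χ.symm (u, 0) ∈ S := by
      rw [hχ.mem_iff _ h, χ.right_inv hu]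
    simpa [hS] using h
  left_inv' q hq := by
    have h0 := (hχ.mem_iff q hq).1 q.2
    have h : χ.symm ((χ q).1, 0) = q := by
      rw [← h0, Prod.mk.eta, χ.left_inv hq]
    simp [h]
  right_inv' u hu := by
    have h := χ.map_target hu
    have hS : χ.symm (u, 0) ∈ S := by
      rw [hχ.mem_iff _ h, χ.right_inv hu]
    simp [hS, χ.right_inv hu]
  open_source := χ.open_source.preimage continuous_subtype_val
  open_target := χ.open_target.preimage (by fun_prop)
  continuousOn_toFun := continuous_fst.comp_continuousOn
    (χ.continuousOn.comp continuous_subtype_val.continuousOn fun _ hq => hq)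
  continuousOn_invFun := by
    rw [Topology.IsInducing.subtypeVal.continuousOn_iff]
    refine (χ.continuousOn_symm.comp (f := fun u : V => (u, (0 : F)))
      (by fun_prop) fun u hu => hu).congr fun u hu => ?_
    have h := χ.map_target hu
    have hS : χ.symm (u, 0) ∈ S := by
      rw [hχ.mem_iff _ h, χ.right_inv hu]
    simp [hS]

theorem coe_sliceChart_symm {χ : OpenPartialHomeomorph M (V × F)} (hχ : IsSliceChart I S χ)
    (p : S) {u : V} (hu : u ∈ (sliceChart χ hχ p).target) :
    ((sliceChart χ hχ p).symm u : M) = χ.symm (u, 0) := by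
  have h := χ.map_target hu
  have hS : χ.symm (u, 0) ∈ S := by
    rw [hχ.mem_iff _ h, χ.right_inv hu]
  simp [sliceChart, hS]

/-- The manifold structure on a subset with slice charts. -/
abbrev sliceChartedSpace (χ : S → OpenPartialHomeomorph M (V × F))
    (hχ : ∀ p, IsSliceChart I S (χ p)) (hp : ∀ p : S, (p : M) ∈ (χ p).source) :
    ChartedSpace V S where
  atlas := Set.range fun p => sliceChart (χ p) (hχ p) p
  chartAt p := sliceChart (χ p) (hχ p) p
  mem_chart_source p := hp p
  chart_mem_atlas p := ⟨p, rfl⟩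

theorem isManifold_slice (χ : S → OpenPartialHomeomorph M (V × F))
    (hχ : ∀ p, IsSliceChart I S (χ p)) (hp : ∀ p : S, (p : M) ∈ (χ p).source) :
    letI := sliceChartedSpace χ hχ hp
    IsManifold 𝓘(ℝ, V) ∞ S := by
  let _ := sliceChartedSpace χ hχ hp
  refine isManifold_of_contDiffOn _ _ _ ?_
  rintro _ _ ⟨p, rfl⟩ ⟨q, rfl⟩
  simp only [modelWithCornersSelf_coe, modelWithCornersSelf_coe_symm, Set.preimage_id_eq, id_eq,
    Set.range_id, Set.inter_univ, Function.id_comp, Function.comp_id]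
  rw [← contMDiffOn_iff_contDiffOn]
  have h1 : ContMDiffOn 𝓘(ℝ, V) 𝓘(ℝ, V × F) ∞ (fun u : V => (u, (0 : F))) Set.univ := by
    have : ContDiff ℝ ∞ (fun u : V => (u, (0 : F))) := by fun_prop
    exact this.contMDiff.contMDiffOn
  have h2 : ContMDiffOn 𝓘(ℝ, V × F) 𝓘(ℝ, V) ∞ (Prod.fst : V × F → V) Set.univ :=
    contDiff_fst.contMDiff.contMDiffOn
  have hsrc : ∀ u ∈ ((sliceChart (χ p) (hχ p) p).symm.trans (sliceChart (χ q) (hχ q) q)).source,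
      (u, (0 : F)) ∈ (χ p).target ∧ (χ p).symm (u, 0) ∈ (χ q).source := by
    intro u hu
    have h1 : u ∈ (sliceChart (χ p) (hχ p) p).target := hu.1
    have h2 : ((sliceChart (χ p) (hχ p) p).symm u : M) ∈ (χ q).source := hu.2
    rw [coe_sliceChart_symm (hχ p) p h1] at h2
    exact ⟨h1, h2⟩
  have h3 := (hχ p).contMDiffOn_symm.comp (s := ((sliceChart (χ p) (hχ p) p).symm.trans
    (sliceChart (χ q) (hχ q) q)).source) (h1.mono (Set.subset_univ _)) fun u hu => (hsrc u hu).1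
  have h4 := h2.comp ((hχ q).contMDiffOn.comp h3 fun u hu => (hsrc u hu).2)
    fun _ _ => Set.mem_univ _
  refine h4.congr fun u hu => ?_
  have h1 : u ∈ (sliceChart (χ p) (hχ p) p).target := hu.1
  change ((χ q) ((sliceChart (χ p) (hχ p) p).symm u : M)).1 = _
  rw [coe_sliceChart_symm (hχ p) p h1]
  rfl

theorem isSmoothEmbedding_slice [FiniteDimensional ℝ E] [FiniteDimensional ℝ V]
    [FiniteDimensional ℝ F] [I.Boundaryless] [IsManifold I ∞ M]
    (hfin : Module.finrank ℝ V + Module.finrank ℝ F = Module.finrank ℝ E)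
    (χ : S → OpenPartialHomeomorph M (V × F))
    (hχ : ∀ p, IsSliceChart I S (χ p)) (hp : ∀ p : S, (p : M) ∈ (χ p).source) :
    letI := sliceChartedSpace χ hχ hp
    Manifold.IsSmoothEmbedding 𝓘(ℝ, V) I ∞ (Subtype.val : S → M) := by
  let _ := sliceChartedSpace χ hχ hp
  have := isManifold_slice χ hχ hp
  refine ⟨Manifold.IsImmersionOfComplement.isImmersion (F := F) fun p => ?_,
    Topology.IsEmbedding.subtypeVal⟩
  let T : (V × F) ≃L[ℝ] E := ContinuousLinearEquiv.ofFinrankEq (by rw [Module.finrank_prod, hfin])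
  let ψ : OpenPartialHomeomorph M H :=
    ((χ p).trans T.toHomeomorph.toOpenPartialHomeomorph).trans
      I.toHomeomorph.symm.toOpenPartialHomeomorph
  have hψs : ψ.source = (χ p).source := by simp [ψ]
  have hψt : ∀ z, z ∈ ψ.target ↔ T.symm (I z) ∈ (χ p).target := by
    intro z
    simp [ψ]
  have hIsymm : ContMDiff 𝓘(ℝ, E) I ∞ I.symm := by
    have := I.contMDiffOn_symm (n := ∞)
    rwa [I.range_eq_univ, contMDiffOn_univ] at this
  have hψ : ψ ∈ IsManifold.maximalAtlas I ∞ M := by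
    refine ψ.mem_maximalAtlas_of_contMDiffOn ?_ ?_
    · rw [hψs]
      exact hIsymm.comp_contMDiffOn (T.contDiff.contMDiff.comp_contMDiffOn (hχ p).contMDiffOn)
    · exact (hχ p).contMDiffOn_symm.comp
        ((T.symm.contDiff.contMDiff.comp I.contMDiff).contMDiffOn) fun z hz => (hψt z).1 hz
  refine Manifold.IsImmersionAtOfComplement.mk_of_charts T (chartAt V p) ψ (mem_chart_source V p)
    (by rw [hψs]; exact hp p) (IsManifold.chart_mem_maximalAtlas p) hψ ?_ ?_
  · intro q hq
    rw [Set.mem_preimage, hψs]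
    exact hq
  · intro u hu
    have hu' : u ∈ (sliceChart (χ p) (hχ p) p).target := by
      have := hu
      rw [OpenPartialHomeomorph.extend_target] at this
      exact this.1
    change I (I.symm (T (χ p ((sliceChart (χ p) (hχ p) p).symm u : M)))) = T (u, 0)
    rw [coe_sliceChart_symm (hχ p) p hu', (χ p).right_inv hu', I.right_inv]
    rw [I.range_eq_univ]
    exact Set.mem_univ _

/-- The differential of the inclusion of a subset with slice charts has a left inverse. -/
theorem exists_leftInverse_mfderiv_slice
    (χ : S → OpenPartialHomeomorph M (V × F))
    (hχ : ∀ p, IsSliceChart I S (χ p)) (hp : ∀ p : S, (p : M) ∈ (χ p).source)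
    (hι : letI := sliceChartedSpace χ hχ hp; ContMDiff 𝓘(ℝ, V) I ∞ (Subtype.val : S → M)) (p : S) :
    letI := sliceChartedSpace χ hχ hp
    ∃ r : TangentSpace I (p : M) →L[ℝ] TangentSpace 𝓘(ℝ, V) p,
      r.comp (mfderiv 𝓘(ℝ, V) I (Subtype.val : S → M) p) = ContinuousLinearMap.id ℝ _ := by
  let _ := sliceChartedSpace χ hχ hp
  have := isManifold_slice χ hχ hp
  have hc : MDifferentiableAt I 𝓘(ℝ, V) (fun q => (χ p q).1) (p : M) := by
    have h1 : ContMDiffAt I 𝓘(ℝ, V × F) ∞ (χ p) (p : M) :=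
      (hχ p).contMDiffOn.contMDiffAt ((χ p).open_source.mem_nhds (hp p))
    have h2 : ContMDiff 𝓘(ℝ, V × F) 𝓘(ℝ, V) ∞ (Prod.fst : V × F → V) := contDiff_fst.contMDiff
    exact ((h2 _).comp (p : M) h1).mdifferentiableAt (by simp)
  refine ⟨mfderiv I 𝓘(ℝ, V) (fun q => (χ p q).1) (p : M), ?_⟩
  have h := mfderiv_comp p hc ((hι p).mdifferentiableAt (by simp))
  exact h.symm.trans (mfderiv_extChartAt_self (I := 𝓘(ℝ, V)) (x := p))

/-- The tangent space of a level set is the kernel of the differential of the equation. -/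
theorem range_mfderiv_eq_ker {N : Type*} [TopologicalSpace N] [ChartedSpace V N]
    [FiniteDimensional ℝ E] [FiniteDimensional ℝ V] [FiniteDimensional ℝ F]
    (hfin : Module.finrank ℝ V + Module.finrank ℝ F = Module.finrank ℝ E) {ι : N → M}
    {L : M → F} {p : N} (hι : MDifferentiableAt 𝓘(ℝ, V) I ι p)
    (hinj : Function.Injective (mfderiv 𝓘(ℝ, V) I ι p))
    (hL : MDifferentiableAt I 𝓘(ℝ, F) L (ι p))
    (hD : Function.Surjective (mfderiv I 𝓘(ℝ, F) L (ι p)))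
    (hLι : L ∘ ι =ᶠ[𝓝 p] fun _ => 0) {v : TangentSpace I (ι p)}
    (hv : mfderiv I 𝓘(ℝ, F) L (ι p) v = 0) : ∃ w, mfderiv 𝓘(ℝ, V) I ι p w = v := by
  let A : V →ₗ[ℝ] E := (mfderiv 𝓘(ℝ, V) I ι p).toLinearMap
  let D : E →ₗ[ℝ] F := (mfderiv I 𝓘(ℝ, F) L (ι p)).toLinearMap
  have hDA : ∀ w, D (A w) = 0 := by
    intro w
    have h := mfderiv_comp p hL hι
    rw [hLι.mfderiv_eq, mfderiv_const] at h
    exact (DFunLike.congr_fun h w).symm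
  have hle : LinearMap.range A ≤ LinearMap.ker D := by
    rintro _ ⟨w, rfl⟩
    exact hDA w
  have h1 := LinearMap.finrank_range_add_finrank_ker D
  have hDtop : LinearMap.range D = ⊤ := LinearMap.range_eq_top.2 hD
  rw [hDtop, finrank_top] at h1
  have h2 : Module.finrank ℝ (LinearMap.range A) = Module.finrank ℝ V :=
    LinearMap.finrank_range_of_inj hinj
  have h3 : LinearMap.range A = LinearMap.ker D :=
    Submodule.eq_of_le_of_finrank_eq hle (by omega)
  have h4 : (v : E) ∈ LinearMap.range A := by
    rw [h3]; exact hv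
  exact h4

end Slice

section Induced

variable {𝔤 : Type*} [LieRing 𝔤] [LieAlgebra ℝ 𝔤] {t : 𝔤 ⊗[ℝ] 𝔤}
  {E : Type*} [NormedAddCommGroup E] [NormedSpace ℝ E]
  {H : Type*} [TopologicalSpace H] {I : ModelWithCorners ℝ E H}
  {M : Type*} [TopologicalSpace M] [ChartedSpace H M]
  {E' : Type*} [NormedAddCommGroup E'] [NormedSpace ℝ E']
  {H' : Type*} [TopologicalSpace H'] {J : ModelWithCorners ℝ E' H'}
  {N : Type*} [TopologicalSpace N] [ChartedSpace H' N]

open ActionTensor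

/-- The structure induced along an immersion `ι : N → M`, by means of left inverses of the
differentials of `ι`. -/
def inducedTensor (Q : ActionTensor 𝔤 I M) (ι : N → M)
    (r : (p : N) → TangentSpace I (ι p) →L[ℝ] TangentSpace J p) : ActionTensor 𝔤 J N where
  ρ :=
    { toFun := fun u p => r p (Q.ρ u (ι p))
      map_add' := fun u v => by
        funext p
        simp only [map_add, Pi.add_apply]
      map_smul' := fun c u => by
        funext p
        simp only [map_smul, Pi.smul_apply, RingHom.id_apply] }
  π := fun p => LinearMap.mk₂ ℝ (fun α β => Q.π (ι p) (α.comp (r p)) (β.comp (r p)))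
    (fun α α' β => by simp only [ContinuousLinearMap.add_comp, map_add, LinearMap.add_apply])
    (fun c α β => by simp only [ContinuousLinearMap.smul_comp, map_smul, LinearMap.smul_apply])
    (fun α β β' => by simp only [ContinuousLinearMap.add_comp, map_add])
    (fun c α β => by simp only [ContinuousLinearMap.smul_comp, map_smul])

variable {Q : ActionTensor 𝔤 I M} {ι : N → M}
  {r : (p : N) → TangentSpace I (ι p) →L[ℝ] TangentSpace J p}

theorem isQuasiPoissonMap_inducedTensor (hι : ContMDiff J I ∞ ι)
    (hr : ∀ p, (r p).comp (mfderiv J I ι p) = ContinuousLinearMap.id ℝ _)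
    (hskew : ∀ (x : M) (α β : TangentSpace I x →L[ℝ] ℝ), Q.π x α β = -Q.π x β α)
    (hρ : ∀ (u : 𝔤) (p : N), ∃ w, mfderiv J I ι p w = Q.ρ u (ι p))
    (hπ : ∀ (p : N) (α β : TangentSpace I (ι p) →L[ℝ] ℝ),
      α.comp (mfderiv J I ι p) = 0 → Q.π (ι p) α β = 0) :
    IsQuasiPoissonMap (inducedTensor Q ι r) Q ι where
  smooth := hι
  equivariant u p := by
    obtain ⟨w, hw⟩ := hρ u p
    have h : r p (Q.ρ u (ι p)) = w := by
      rw [← hw]; exact DFunLike.congr_fun (hr p) w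
    change mfderiv J I ι p (r p (Q.ρ u (ι p))) = _
    rw [h, hw]
  map_bivector p α β := by
    have key : ∀ α β : TangentSpace I (ι p) →L[ℝ] ℝ,
        Q.π (ι p) ((α.comp (mfderiv J I ι p)).comp (r p)) β = Q.π (ι p) α β := by
      intro α β
      rw [← sub_eq_zero, ← LinearMap.sub_apply, ← map_sub]
      refine hπ p _ β ?_
      rw [ContinuousLinearMap.sub_comp, ContinuousLinearMap.comp_assoc, hr,
        ContinuousLinearMap.comp_id, sub_self]
    change Q.π (ι p) ((α.comp (mfderiv J I ι p)).comp (r p))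
      ((β.comp (mfderiv J I ι p)).comp (r p)) = _
    rw [key, hskew, key, hskew, neg_neg]

theorem mvfderiv_comp_eq {f : M → ℝ} (hf : ContMDiff I 𝓘(ℝ, ℝ) ∞ f) (hι : ContMDiff J I ∞ ι)
    (p : N) :
    mvfderiv J (f ∘ ι) p = (mvfderiv I f (ι p)).comp (mfderiv J I ι p) :=
  mvfderiv_comp p (mdifferentiableAt_of_contMDiff hf _) (hι.mdifferentiableAt (by simp))

section Map

variable {QN : ActionTensor 𝔤 J N}

theorem IsEquivariant.coaction_comp (h : IsEquivariant QN Q ι) (p : N)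
    (α : TangentSpace I (ι p) →L[ℝ] ℝ) :
    QN.coaction p (α.comp (mfderiv J I ι p)) = Q.coaction (ι p) α := by
  ext u
  exact congrArg α (h u p)

theorem IsQuasiPoissonMap.lieDeriv_comp (h : IsQuasiPoissonMap QN Q ι) (u : 𝔤) {f : M → ℝ}
    (hf : ContMDiff I 𝓘(ℝ, ℝ) ∞ f) : QN.lieDeriv u (f ∘ ι) = Q.lieDeriv u f ∘ ι := by
  funext p
  rw [← coaction_mvfderiv, mvfderiv_comp_eq hf h.smooth, h.equivariant.coaction_comp]
  rfl

theorem IsQuasiPoissonMap.bracket_comp (h : IsQuasiPoissonMap QN Q ι) {f g : M → ℝ}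
    (hf : ContMDiff I 𝓘(ℝ, ℝ) ∞ f) (hg : ContMDiff I 𝓘(ℝ, ℝ) ∞ g) :
    QN.bracket (f ∘ ι) (g ∘ ι) = Q.bracket f g ∘ ι := by
  funext p
  rw [bracket, mvfderiv_comp_eq hf h.smooth, mvfderiv_comp_eq hg h.smooth, h.map_bivector]
  rfl

theorem IsQuasiPoissonMap.sigma_comp (h : IsQuasiPoissonMap QN Q ι) (p : N)
    (α β : TangentSpace I (ι p) →L[ℝ] ℝ) :
    QN.sigma t p (α.comp (mfderiv J I ι p)) (β.comp (mfderiv J I ι p)) = Q.sigma t (ι p) α β := by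
  rw [sigma, h.map_bivector, h.equivariant.coaction_comp, h.equivariant.coaction_comp]
  rfl

/-- A structure for which an immersion into a quasi-Poisson manifold is a quasi-Poisson map is
quasi-Poisson. -/
theorem IsQuasiPoissonMap.isQuasiPoisson [FiniteDimensional ℝ E] [FiniteDimensional ℝ E']
    [I.Boundaryless] [J.Boundaryless] [IsManifold I ∞ M] [IsManifold J ∞ N] [T2Space M]
    (ht_symm : TensorProduct.comm ℝ 𝔤 𝔤 t = t) (ht_inv : ∀ u : 𝔤, ⁅u, t⁆ = 0)
    (h : IsQuasiPoissonMap QN Q ι) (hQ : Q.IsQuasiPoisson t)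
    (hr : ∀ p, (r p).comp (mfderiv J I ι p) = ContinuousLinearMap.id ℝ _) :
    QN.IsQuasiPoisson t := by
  have hext : ∀ (p : N) (α : TangentSpace J p →L[ℝ] ℝ),
      (α.comp (r p)).comp (mfderiv J I ι p) = α := by
    intro p α
    rw [ContinuousLinearMap.comp_assoc, hr, ContinuousLinearMap.comp_id]
  have hS : IsGenerating J {g : N → ℝ | ∃ f : M → ℝ, ContMDiff I 𝓘(ℝ, ℝ) ∞ f ∧ g = f ∘ ι} := by
    refine ⟨?_, fun p α => ?_⟩
    · rintro _ ⟨f, hf, rfl⟩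
      exact hf.comp h.smooth
    · obtain ⟨f, hf, hfα⟩ := exists_contMDiff_mvfderiv_eq (ι p) (α.comp (r p))
      refine Submodule.subset_span ⟨_, ⟨f, hf, rfl⟩, ?_⟩
      change mvfderiv J (f ∘ ι) p = α
      rw [mvfderiv_comp_eq hf h.smooth, hfα, hext]
  refine IsQuasiPoisson.of_isGenerating ht_symm ht_inv hS ?_ ?_ ?_ ?_ ?_ ?_
  · rintro u _ ⟨f, hf, rfl⟩
    rw [h.lieDeriv_comp u hf]
    exact (hQ.contMDiff_lieDeriv u hf).comp h.smooth
  · rintro u v _ ⟨f, hf, rfl⟩ p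
    rw [h.lieDeriv_comp _ hf, h.lieDeriv_comp _ hf, h.lieDeriv_comp _ hf,
      h.lieDeriv_comp _ (hQ.contMDiff_lieDeriv _ hf),
      h.lieDeriv_comp _ (hQ.contMDiff_lieDeriv _ hf)]
    exact hQ.lieDeriv_lie u v hf (ι p)
  · intro p α β
    rw [← hext p α, ← hext p β, h.map_bivector, h.map_bivector]
    exact hQ.skew _ _ _
  · rintro _ ⟨f, hf, rfl⟩ _ ⟨g, hg, rfl⟩
    rw [h.bracket_comp hf hg]
    exact (hQ.smooth_bivector f g hf hg).comp h.smooth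
  · rintro u _ ⟨f, hf, rfl⟩ _ ⟨g, hg, rfl⟩ p
    rw [h.bracket_comp hf hg, h.lieDeriv_comp u hf, h.lieDeriv_comp u hg,
      h.lieDeriv_comp u (hQ.smooth_bivector f g hf hg),
      h.bracket_comp (hQ.contMDiff_lieDeriv u hf) hg,
      h.bracket_comp hf (hQ.contMDiff_lieDeriv u hg)]
    exact hQ.invariant u f g hf hg (ι p)
  · rintro _ ⟨f, hf, rfl⟩ _ ⟨g, hg, rfl⟩ _ ⟨k, hk, rfl⟩ p
    rw [mvfderiv_comp_eq hf h.smooth, mvfderiv_comp_eq hg h.smooth, mvfderiv_comp_eq hk h.smooth,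
      h.equivariant.coaction_comp, h.equivariant.coaction_comp, h.equivariant.coaction_comp,
      halfSchouten, h.bracket_comp hf hg, h.bracket_comp hg hk, h.bracket_comp hk hf,
      h.bracket_comp hf (hQ.smooth_bivector g k hg hk),
      h.bracket_comp hg (hQ.smooth_bivector k f hk hf),
      h.bracket_comp hk (hQ.smooth_bivector f g hf hg)]
    exact hQ.schouten f g k hf hg hk (ι p)

end Map

end Induced

section FibreProduct

variable {E₁ : Type*} [NormedAddCommGroup E₁] [NormedSpace ℝ E₁]
  {H₁ : Type*} [TopologicalSpace H₁] {I₁ : ModelWithCorners ℝ E₁ H₁}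
  {M₁ : Type*} [TopologicalSpace M₁] [ChartedSpace H₁ M₁]
  {E₂ : Type*} [NormedAddCommGroup E₂] [NormedSpace ℝ E₂]
  {H₂ : Type*} [TopologicalSpace H₂] {I₂ : ModelWithCorners ℝ E₂ H₂}
  {M₂ : Type*} [TopologicalSpace M₂] [ChartedSpace H₂ M₂]
  {F : Type*} [NormedAddCommGroup F] [NormedSpace ℝ F]
  {G : Type*} [TopologicalSpace G] {J : ModelWithCorners ℝ F G}
  {N : Type*} [TopologicalSpace N] [ChartedSpace G N] {f : M₁ → N} {g : M₂ → N}

/-- The differential of a map, as a linear map between the model spaces. -/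
def differential (I₁ : ModelWithCorners ℝ E₁ H₁) (J : ModelWithCorners ℝ F G) (f : M₁ → N)
    (x : M₁) : E₁ →L[ℝ] F :=
  mfderiv I₁ J f x

/-- The map `(v, w) ↦ df v - dg w`. -/
def mfderivDifference (I₁ : ModelWithCorners ℝ E₁ H₁) (I₂ : ModelWithCorners ℝ E₂ H₂)
    (J : ModelWithCorners ℝ F G) (f : M₁ → N) (g : M₂ → N) (p : M₁ × M₂) : E₁ × E₂ →L[ℝ] F :=
  differential I₁ J f p.1 ∘L ContinuousLinearMap.fst ℝ E₁ E₂ -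
    differential I₂ J g p.2 ∘L ContinuousLinearMap.snd ℝ E₁ E₂

theorem mfderivDifference_apply (p : M₁ × M₂) (v : E₁ × E₂) :
    mfderivDifference I₁ I₂ J f g p v =
      differential I₁ J f p.1 v.1 - differential I₂ J g p.2 v.2 :=
  rfl

theorem isTransverseToDiagonal_iff (hf : ∀ x, MDifferentiableAt I₁ J f x)
    (hg : ∀ y, MDifferentiableAt I₂ J g y) :
    IsTransverseToDiagonal I₁ I₂ J f g ↔
      ∀ p ∈ fibreProduct f g, Function.Surjective (mfderivDifference I₁ I₂ J f g p) := by
  have h1 : ∀ p : M₁ × M₂, ∀ v : E₁ × E₂,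
      differential (I₁.prod I₂) (J.prod J) (Prod.map f g) p v =
        (differential I₁ J f p.1 v.1, differential I₂ J g p.2 v.2) :=
    fun p v => DFunLike.congr_fun (mfderiv_prodMap (hf p.1) (hg p.2)) v
  have h2 : ∀ z : N, ∀ c : F,
      differential J (J.prod J) (fun z : N => (z, z)) z c = (c, c) := by
    intro z c
    have h := mfderiv_prodMk (I := J) (x := z) (f := @id N) (g := @id N) mdifferentiableAt_id
      mdifferentiableAt_id
    rw [mfderiv_id] at h
    exact DFunLike.congr_fun h c
  have h3 : IsTransverseToDiagonal I₁ I₂ J f g ↔ ∀ p ∈ fibreProduct f g,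
      LinearMap.range (differential (I₁.prod I₂) (J.prod J) (Prod.map f g) p).toLinearMap ⊔
        LinearMap.range (differential J (J.prod J) (fun z : N => (z, z)) (f p.1)).toLinearMap = ⊤ :=
    ⟨fun h p hp => h p.1 p.2 hp, fun h x y hxy => h (x, y) hxy⟩
  rw [h3]
  refine forall₂_congr fun p hp => ⟨fun h c => ?_, fun h => ?_⟩
  · obtain ⟨_, ⟨v, rfl⟩, _, ⟨z, rfl⟩, hvz⟩ := Submodule.mem_sup.1
      (h.ge (Submodule.mem_top (x := ((c, 0) : F × F))))
    simp only [ContinuousLinearMap.coe_coe, h1, h2, Prod.mk_add_mk, Prod.mk.injEq] at hvz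
    refine ⟨v, ?_⟩
    rw [mfderivDifference_apply, ← hvz.1, eq_neg_of_add_eq_zero_left hvz.2]
    abel
  · refine eq_top_iff.2 fun c _ => ?_
    obtain ⟨v, hv⟩ := h (c.1 - c.2)
    rw [mfderivDifference_apply] at hv
    refine Submodule.mem_sup.2 ⟨_, ⟨v, rfl⟩, _, ⟨c.2 - differential I₂ J g p.2 v.2, rfl⟩, ?_⟩
    simp only [ContinuousLinearMap.coe_coe, h1, h2, Prod.mk_add_mk]
    refine Prod.ext ?_ (add_sub_cancel _ _)
    change differential I₁ J f p.1 v.1 + (c.2 - differential I₂ J g p.2 v.2) = c.1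
    rw [← add_sub_assoc, add_sub_right_comm, hv]
    abel

theorem isTransverseToDiagonal_of_surjective (hf : ∀ x, MDifferentiableAt I₁ J f x)
    (hg : ∀ y, MDifferentiableAt I₂ J g y)
    (h : (∀ x, Function.Surjective (mfderiv I₁ J f x)) ∨
      ∀ y, Function.Surjective (mfderiv I₂ J g y)) :
    IsTransverseToDiagonal I₁ I₂ J f g := by
  rw [isTransverseToDiagonal_iff hf hg]
  intro p _ c
  rcases h with h | h
  · obtain ⟨v, hv⟩ := h p.1 c
    refine ⟨(v, 0), ?_⟩
    rw [mfderivDifference_apply, map_zero, sub_zero]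
    exact hv
  · obtain ⟨w, hw⟩ := h p.2 (-c : F)
    refine ⟨(0, w), ?_⟩
    rw [mfderivDifference_apply, map_zero, zero_sub]
    exact neg_eq_iff_eq_neg.2 hw

theorem hasMFDerivAt_extChartAt_self [IsManifold J 1 N] (z : N) :
    HasMFDerivAt J 𝓘(ℝ, F) (extChartAt J z) z (ContinuousLinearMap.id ℝ F) := by
  have h := (mdifferentiableAt_extChartAt (I := J) (mem_chart_source G z)).hasMFDerivAt
  rwa [mfderiv_extChartAt_self] at h

/-- The local equation of a fibre product in a chart of the base. -/
def chartDifference (J : ModelWithCorners ℝ F G) (f : M₁ → N) (g : M₂ → N) (z : N)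
    (q : M₁ × M₂) : F :=
  extChartAt J z (f q.1) - extChartAt J z (g q.2)

/-- The open set on which the local equation of a fibre product is valid. -/
def chartDifferenceSource (G : Type*) [TopologicalSpace G] [ChartedSpace G N]
    (f : M₁ → N) (g : M₂ → N) (z : N) : Set (M₁ × M₂) :=
  {q | f q.1 ∈ (chartAt G z).source ∧ g q.2 ∈ (chartAt G z).source}

theorem isOpen_chartDifferenceSource (hf : Continuous f) (hg : Continuous g) (z : N) :
    IsOpen (chartDifferenceSource G f g z) :=
  ((chartAt G z).open_source.preimage (hf.comp continuous_fst)).inter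
    ((chartAt G z).open_source.preimage (hg.comp continuous_snd))

omit [TopologicalSpace M₁] [TopologicalSpace M₂] in
theorem mem_fibreProduct_iff_chartDifference {z : N} {q : M₁ × M₂}
    (hq : q ∈ chartDifferenceSource G f g z) :
    q ∈ fibreProduct f g ↔ chartDifference J f g z q = 0 := by
  rw [chartDifference, sub_eq_zero]
  refine ⟨fun h => congrArg _ h, fun h => (extChartAt J z).injOn ?_ ?_ h⟩
  · rw [extChartAt_source]; exact hq.1
  · rw [extChartAt_source]; exact hq.2

theorem contMDiffOn_chartDifference [IsManifold J ∞ N] (hf : ContMDiff I₁ J ∞ f)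
    (hg : ContMDiff I₂ J ∞ g) (z : N) :
    ContMDiffOn (I₁.prod I₂) 𝓘(ℝ, F) ∞ (chartDifference J f g z)
      (chartDifferenceSource G f g z) :=
  (contMDiffOn_extChartAt.comp (hf.comp contMDiff_fst).contMDiffOn fun _ hq => hq.1).sub
    (contMDiffOn_extChartAt.comp (hg.comp contMDiff_snd).contMDiffOn fun _ hq => hq.2)

theorem mfderiv_chartDifference [IsManifold J 1 N] {p : M₁ × M₂}
    (hp : p ∈ fibreProduct f g) (hf : MDifferentiableAt I₁ J f p.1)
    (hg : MDifferentiableAt I₂ J g p.2) :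
    mfderiv (I₁.prod I₂) 𝓘(ℝ, F) (chartDifference J f g (f p.1)) p =
      mfderivDifference I₁ I₂ J f g p := by
  have h1 : HasMFDerivAt J 𝓘(ℝ, F) (extChartAt J (f p.1)) (f p.1) (ContinuousLinearMap.id ℝ F) :=
    hasMFDerivAt_extChartAt_self _
  have h2 : ∀ z, z = f p.1 →
      HasMFDerivAt J 𝓘(ℝ, F) (extChartAt J (f p.1)) z (ContinuousLinearMap.id ℝ F) := by
    rintro _ rfl
    exact h1
  have h3 := h1.comp p (f := fun q : M₁ × M₂ => f q.1)
    (hf.hasMFDerivAt.comp p (hasMFDerivAt_fst (I := I₁) (I' := I₂) p))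
  have h4 := (h2 (g p.2) hp.symm).comp p (f := fun q : M₁ × M₂ => g q.2)
    (hg.hasMFDerivAt.comp p (hasMFDerivAt_snd (I := I₁) (I' := I₂) p))
  exact (h3.sub h4).mfderiv

/-- A transverse fibre product is an embedded submanifold, with the expected tangent spaces. -/
theorem exists_isSmoothEmbedding_fibreProduct [FiniteDimensional ℝ E₁] [FiniteDimensional ℝ E₂]
    [FiniteDimensional ℝ F] [I₁.Boundaryless] [I₂.Boundaryless]
    [IsManifold I₁ ∞ M₁] [IsManifold I₂ ∞ M₂] [IsManifold J ∞ N]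
    (hf : ContMDiff I₁ J ∞ f) (hg : ContMDiff I₂ J ∞ g)
    (h : ∀ p ∈ fibreProduct f g, Function.Surjective (mfderivDifference I₁ I₂ J f g p)) :
    ∃ (k : ℕ) (_ : ChartedSpace (EuclideanSpace ℝ (Fin k)) (fibreProduct f g)),
      IsManifold (𝓡 k) ∞ (fibreProduct f g) ∧
      Manifold.IsSmoothEmbedding (𝓡 k) (I₁.prod I₂) ∞ (Subtype.val : fibreProduct f g → M₁ × M₂) ∧
      ∀ p : fibreProduct f g,
        (∃ r : TangentSpace (I₁.prod I₂) (p : M₁ × M₂) →L[ℝ] TangentSpace (𝓡 k) p,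
          r.comp (mfderiv (𝓡 k) (I₁.prod I₂) (Subtype.val : fibreProduct f g → M₁ × M₂) p) =
            ContinuousLinearMap.id ℝ _) ∧
        ∀ v : TangentSpace (I₁.prod I₂) (p : M₁ × M₂), mfderivDifference I₁ I₂ J f g p v = 0 →
          ∃ w, mfderiv (𝓡 k) (I₁.prod I₂) (Subtype.val : fibreProduct f g → M₁ × M₂) p w = v := by
  rcases isEmpty_or_nonempty (fibreProduct f g) with hS | ⟨⟨p₀⟩⟩
  · let _ := ChartedSpace.empty (EuclideanSpace ℝ (Fin 0)) (fibreProduct f g)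
    refine ⟨0, inferInstance, ?_, ⟨?_, Topology.IsEmbedding.subtypeVal⟩, fun p => isEmptyElim p⟩
    · refine isManifold_of_contDiffOn _ _ _ ?_
      rintro e _ he
      exact absurd he (Set.notMem_empty e)
    · exact Manifold.IsImmersionOfComplement.isImmersion (F := F) fun p => isEmptyElim p
  have hk : Module.finrank ℝ (E₁ × E₂) - Module.finrank ℝ F + Module.finrank ℝ F =
      Module.finrank ℝ (E₁ × E₂) :=
    Nat.sub_add_cancel (LinearMap.finrank_le_finrank_of_surjective
      (f := (mfderivDifference I₁ I₂ J f g p₀).toLinearMap) (h p₀ p₀.2))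
  generalize Module.finrank ℝ (E₁ × E₂) - Module.finrank ℝ F = k at hk
  have hfin : Module.finrank ℝ (EuclideanSpace ℝ (Fin k)) + Module.finrank ℝ F =
      Module.finrank ℝ (E₁ × E₂) := by rw [finrank_euclideanSpace_fin, hk]
  have hd : ∀ p : fibreProduct f g, mfderiv (I₁.prod I₂) 𝓘(ℝ, F)
      (chartDifference J f g (f (p : M₁ × M₂).1)) p = mfderivDifference I₁ I₂ J f g p :=
    fun p => mfderiv_chartDifference p.2 (hf.mdifferentiableAt (by simp))
      (hg.mdifferentiableAt (by simp))
  have hmem : ∀ p : fibreProduct f g,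
      (p : M₁ × M₂) ∈ chartDifferenceSource G f g (f (p : M₁ × M₂).1) := by
    intro p
    refine ⟨mem_chart_source G _, ?_⟩
    have hp : f (p : M₁ × M₂).1 = g (p : M₁ × M₂).2 := p.2
    rw [← hp]
    exact mem_chart_source G _
  have hsurj : ∀ p : fibreProduct f g, Function.Surjective (mfderiv (I₁.prod I₂) 𝓘(ℝ, F)
      (chartDifference J f g (f (p : M₁ × M₂).1)) p) := by
    intro p c
    obtain ⟨v, hv⟩ := h p p.2 c
    exact ⟨v, (DFunLike.congr_fun (hd p) v).trans hv⟩
  have hopen : ∀ p : fibreProduct f g,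
      IsOpen (chartDifferenceSource G f g (f (p : M₁ × M₂).1)) :=
    fun p => isOpen_chartDifferenceSource hf.continuous hg.continuous _
  have hchart : ∀ p : fibreProduct f g,
      ∃ χ : OpenPartialHomeomorph (M₁ × M₂) (EuclideanSpace ℝ (Fin k) × F),
        (p : M₁ × M₂) ∈ χ.source ∧ IsSliceChart (I₁.prod I₂) (fibreProduct f g) χ :=
    fun p => exists_isSliceChart (hopen p) (contMDiffOn_chartDifference hf hg _)
      (fun q hq => mem_fibreProduct_iff_chartDifference hq) (hmem p) (hsurj p) hk
  choose χ hp hχ using hchart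
  let _ := sliceChartedSpace χ hχ hp
  have hι := isSmoothEmbedding_slice hfin χ hχ hp
  refine ⟨k, inferInstance, isManifold_slice χ hχ hp, hι, fun p => ?_⟩
  obtain ⟨r, hr⟩ := exists_leftInverse_mfderiv_slice χ hχ hp hι.contMDiff p
  refine ⟨⟨r, hr⟩, fun v hv => ?_⟩
  refine range_mfderiv_eq_ker hfin (L := chartDifference J f g (f (p : M₁ × M₂).1))
    (hι.contMDiff.mdifferentiableAt (by simp)) (fun w w' hw => ?_) ?_ (hsurj p) ?_
    ((DFunLike.congr_fun (hd p) v).trans hv)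
  · have h1 := congrArg r hw
    exact (DFunLike.congr_fun hr w).symm.trans (h1.trans (DFunLike.congr_fun hr w'))
  · exact ((contMDiffOn_chartDifference hf hg _).contMDiffAt
      ((hopen p).mem_nhds (hmem p))).mdifferentiableAt (by simp)
  · filter_upwards [((hopen p).preimage continuous_subtype_val).mem_nhds (hmem p)] with q hq
    exact (mem_fibreProduct_iff_chartDifference hq).1 q.2

end FibreProduct

section Central

variable {𝔤 : Type*} [LieRing 𝔤] [LieAlgebra ℝ 𝔤] {t : 𝔤 ⊗[ℝ] 𝔤}
  {E₁ : Type*} [NormedAddCommGroup E₁] [NormedSpace ℝ E₁]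
  {H₁ : Type*} [TopologicalSpace H₁] {I₁ : ModelWithCorners ℝ E₁ H₁}
  {M₁ : Type*} [TopologicalSpace M₁] [ChartedSpace H₁ M₁]
  {E₂ : Type*} [NormedAddCommGroup E₂] [NormedSpace ℝ E₂]
  {H₂ : Type*} [TopologicalSpace H₂] {I₂ : ModelWithCorners ℝ E₂ H₂}
  {M₂ : Type*} [TopologicalSpace M₂] [ChartedSpace H₂ M₂]
  {E₃ : Type*} [NormedAddCommGroup E₃] [NormedSpace ℝ E₃]
  {H₃ : Type*} [TopologicalSpace H₃] {I₃ : ModelWithCorners ℝ E₃ H₃}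
  {M₃ : Type*} [TopologicalSpace M₃] [ChartedSpace H₃ M₃]
  {Q₁ : ActionTensor 𝔤 I₁ M₁} {Q₂ : ActionTensor 𝔤 I₂ M₂} {Q₃ : ActionTensor 𝔤 I₃ M₃}

open ActionTensor

theorem tensorEval_add_left (α α' β : Module.Dual ℝ 𝔤) :
    tensorEval t (α + α') β = tensorEval t α β + tensorEval t α' β := by
  simp [tensorEval, TensorProduct.add_tmul]

theorem tensorEval_add_right (α β β' : Module.Dual ℝ 𝔤) :
    tensorEval t α (β + β') = tensorEval t α β + tensorEval t α β' := by
  simp [tensorEval, TensorProduct.tmul_add]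

theorem tensorEval_neg_left (α β : Module.Dual ℝ 𝔤) :
    tensorEval t (-α) β = -tensorEval t α β := by
  rw [eq_neg_iff_add_eq_zero, ← tensorEval_add_left, neg_add_cancel, tensorEval_zero_left]

theorem IsEquivariant.comp {f : M₁ → M₂} {g : M₂ → M₃} (hg : IsEquivariant Q₂ Q₃ g)
    (hf : IsEquivariant Q₁ Q₂ f) (hgs : ∀ y, MDifferentiableAt I₂ I₃ g y)
    (hfs : ∀ x, MDifferentiableAt I₁ I₂ f x) : IsEquivariant Q₁ Q₃ (g ∘ f) := by
  intro u x
  rw [mfderiv_comp x (hgs _) (hfs _)]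
  exact (congrArg (mfderiv I₂ I₃ g (f x)) (hf u x)).trans (hg u (f x))

theorem isEquivariant_fst : IsEquivariant (fusion t Q₁ Q₂) Q₁ (Prod.fst : M₁ × M₂ → M₁) := by
  intro u p
  rw [mfderiv_fst]
  exact add_zero (Q₁.ρ u p.1)

theorem isEquivariant_snd : IsEquivariant (fusion t Q₁ Q₂) Q₂ (Prod.snd : M₁ × M₂ → M₂) := by
  intro u p
  rw [mfderiv_snd]
  exact zero_add (Q₂.ρ u p.2)

theorem ActionTensor.IsLeftCentral.comp_fst {a : M₁ → ℝ} (h : Q₁.IsLeftCentral t a)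
    (ha : ContMDiff I₁ 𝓘(ℝ, ℝ) ∞ a) : (fusion t Q₁ Q₂).IsLeftCentral t (a ∘ Prod.fst) := by
  intro p β
  have hd := mdifferentiableAt_of_contMDiff ha p.1
  have h1 := h p.1 (β.comp (tangentInl p))
  rw [sigma] at h1
  rw [sigma, fusion_pi_apply, fusion_coaction_fst ha, fusion_coaction,
    mvfderiv_comp_fst_comp_tangentInl hd, mvfderiv_comp_fst_comp_tangentInr hd, coaction_zero,
    tensorEval_zero_left, tensorEval_add_right, map_zero, LinearMap.zero_apply]
  linear_combination h1

theorem ActionTensor.IsRightCentral.comp_snd {b : M₂ → ℝ} (h : Q₂.IsRightCentral t b)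
    (hb : ContMDiff I₂ 𝓘(ℝ, ℝ) ∞ b) : (fusion t Q₁ Q₂).IsRightCentral t (b ∘ Prod.snd) := by
  intro p α
  have hd := mdifferentiableAt_of_contMDiff hb p.2
  have h1 := h p.2 (α.comp (tangentInr p))
  rw [sigma] at h1
  rw [sigma, fusion_pi_apply, fusion_coaction_snd hb, fusion_coaction,
    mvfderiv_comp_snd_comp_tangentInl hd, mvfderiv_comp_snd_comp_tangentInr hd, coaction_zero,
    tensorEval_zero_right, tensorEval_add_left, map_zero]
  linear_combination h1

section Restrict

variable {ι : M₁ → M₂} {r : (p : M₁) → TangentSpace I₂ (ι p) →L[ℝ] TangentSpace I₁ p}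

theorem ActionTensor.IsLeftCentral.comp_isQuasiPoissonMap {a : M₂ → ℝ}
    (h : Q₂.IsLeftCentral t a) (ha : ContMDiff I₂ 𝓘(ℝ, ℝ) ∞ a) (hι : IsQuasiPoissonMap Q₁ Q₂ ι)
    (hr : ∀ p, (r p).comp (mfderiv I₁ I₂ ι p) = ContinuousLinearMap.id ℝ _) :
    Q₁.IsLeftCentral t (a ∘ ι) := by
  intro p β
  have hβ : (β.comp (r p)).comp (mfderiv I₁ I₂ ι p) = β := by
    rw [ContinuousLinearMap.comp_assoc, hr, ContinuousLinearMap.comp_id]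
  rw [mvfderiv_comp_eq ha hι.smooth, ← hβ, hι.sigma_comp]
  exact h (ι p) _

theorem ActionTensor.IsRightCentral.comp_isQuasiPoissonMap {a : M₂ → ℝ}
    (h : Q₂.IsRightCentral t a) (ha : ContMDiff I₂ 𝓘(ℝ, ℝ) ∞ a) (hι : IsQuasiPoissonMap Q₁ Q₂ ι)
    (hr : ∀ p, (r p).comp (mfderiv I₁ I₂ ι p) = ContinuousLinearMap.id ℝ _) :
    Q₁.IsRightCentral t (a ∘ ι) := by
  intro p α
  have hα : (α.comp (r p)).comp (mfderiv I₁ I₂ ι p) = α := by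
    rw [ContinuousLinearMap.comp_assoc, hr, ContinuousLinearMap.comp_id]
  rw [mvfderiv_comp_eq ha hι.smooth, ← hα, hι.sigma_comp]
  exact h (ι p) _

end Restrict

theorem mfderivDifference_fusion_ρ {f : M₁ → M₃} {g : M₂ → M₃} (hf : IsEquivariant Q₁ Q₃ f)
    (hg : IsEquivariant Q₂ Q₃ g) (u : 𝔤) {p : M₁ × M₂} (hp : p ∈ fibreProduct f g) :
    mfderivDifference I₁ I₂ I₃ f g p ((fusion t Q₁ Q₂).ρ u p) = 0 := by
  have h1 : ((fusion t Q₁ Q₂).ρ u p : E₁ × E₂) = (Q₁.ρ u p.1, Q₂.ρ u p.2) :=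
    Prod.ext (add_zero (Q₁.ρ u p.1 : E₁)) (zero_add (Q₂.ρ u p.2 : E₂))
  have h2 : (Q₃.ρ u (f p.1) : E₃) = Q₃.ρ u (g p.2) := by
    have h : ∀ z z' : M₃, z = z' → (Q₃.ρ u z : E₃) = Q₃.ρ u z' := by rintro _ _ rfl; rfl
    exact h _ _ hp
  refine (congrArg (mfderivDifference I₁ I₂ I₃ f g p) h1).trans ?_
  refine sub_eq_zero.2 ?_
  exact (hf u p.1).trans (h2.trans (hg u p.2).symm)

/-- The fusion bivector kills conormal covectors of the fibre product of a right central map and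
a left central map. -/
theorem fusion_pi_eq_zero_of_conormal [FiniteDimensional ℝ E₃] [I₃.Boundaryless]
    [IsManifold I₃ ∞ M₃] [T2Space M₃]
    (ht_symm : TensorProduct.comm ℝ 𝔤 𝔤 t = t) {f : M₁ → M₃} {g : M₂ → M₃}
    (hf : IsRightCentralMap t Q₁ Q₃ f) (hg : IsLeftCentralMap t Q₂ Q₃ g)
    (hskew : ∀ (x : M₁) (α β : TangentSpace I₁ x →L[ℝ] ℝ), Q₁.π x α β = -Q₁.π x β α)
    {p : M₁ × M₂} (hp : p ∈ fibreProduct f g) {α : TangentSpace (I₁.prod I₂) p →L[ℝ] ℝ}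
    (hα : ∀ v : TangentSpace (I₁.prod I₂) p, mfderivDifference I₁ I₂ I₃ f g p v = 0 → α v = 0)
    (β : TangentSpace (I₁.prod I₂) p →L[ℝ] ℝ) : (fusion t Q₁ Q₂).π p α β = 0 := by
  obtain ⟨ξ, hξ⟩ : ∃ ξ : E₃ →L[ℝ] ℝ, ∀ v : E₁ × E₂,
      α v = ξ (mfderivDifference I₁ I₂ I₃ f g p v) := by
    have h : (α.toLinearMap : Module.Dual ℝ (E₁ × E₂)) ∈
        LinearMap.range (mfderivDifference I₁ I₂ I₃ f g p).toLinearMap.dualMap := by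
      rw [LinearMap.range_dualMap_eq_dualAnnihilator_ker]
      exact (Submodule.mem_dualAnnihilator _).2 fun v hv => hα v hv
    obtain ⟨ξ, hξ⟩ := h
    exact ⟨LinearMap.toContinuousLinearMap ξ, fun v => (DFunLike.congr_fun hξ v).symm⟩
  obtain ⟨c, hc, hcξ⟩ := exists_contMDiff_mvfderiv_eq (I := I₃) (f p.1) ξ
  have hcξ' : (mvfderiv I₃ c (g p.2) : E₃ →L[ℝ] ℝ) = ξ := by
    have h : ∀ z, z = f p.1 → (mvfderiv I₃ c z : E₃ →L[ℝ] ℝ) = ξ := by rintro _ rfl; exact hcξ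
    exact h _ hp.symm
  have hfd := mvfderiv_comp_eq hc hf.smooth p.1
  have hgd := mvfderiv_comp_eq hc hg.smooth p.2
  have h1 : α.comp (tangentInl p) = mvfderiv I₁ (c ∘ f) p.1 := by
    rw [hfd, hcξ]
    ext v
    refine (hξ (v, 0)).trans (congrArg ξ ?_)
    rw [mfderivDifference_apply, map_zero, sub_zero]
    rfl
  have h2 : α.comp (tangentInr p) = -mvfderiv I₂ (c ∘ g) p.2 := by
    rw [hgd]
    ext w
    refine (hξ (0, w)).trans ?_
    rw [mfderivDifference_apply, map_zero, zero_sub, map_neg, ← hcξ']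
    rfl
  have h3 : Q₁.coaction p.1 (mvfderiv I₁ (c ∘ f) p.1) =
      Q₂.coaction p.2 (mvfderiv I₂ (c ∘ g) p.2) := by
    rw [hfd, hgd, hf.equivariant.coaction_comp, hg.equivariant.coaction_comp]
    have h : ∀ z z' : M₃, z = z' →
        Q₃.coaction z (mvfderiv I₃ c z) = Q₃.coaction z' (mvfderiv I₃ c z') := by
      rintro _ _ rfl; rfl
    exact h _ _ hp
  have h4 := hf.central c hc p.1 (β.comp (tangentInl p))
  have h5 := hg.central c hc p.2 (β.comp (tangentInr p))
  have h6 : Q₂.coaction p.2 (-mvfderiv I₂ (c ∘ g) p.2) =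
      -Q₂.coaction p.2 (mvfderiv I₂ (c ∘ g) p.2) := (Q₂.coactionLinear p.2).map_neg _
  rw [sigma] at h4 h5
  rw [tensorEval_swap ht_symm, h3] at h4
  rw [fusion_pi_apply, h1, h2, hskew, h3, h6, map_neg, LinearMap.neg_apply, tensorEval_neg_left]
  linear_combination -h4 - h5

end Central

end QuasiPoisson

end

theorem mainTheorem5
    {𝔤 : Type*} [LieRing 𝔤] [LieAlgebra ℝ 𝔤]
    (t : 𝔤 ⊗[ℝ] 𝔤) (ht_symm : TensorProduct.comm ℝ 𝔤 𝔤 t = t) (ht_inv : ∀ u : 𝔤, ⁅u, t⁆ = 0)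
    {E₁ : Type*} [NormedAddCommGroup E₁] [NormedSpace ℝ E₁] [FiniteDimensional ℝ E₁]
    {H₁ : Type*} [TopologicalSpace H₁] {I₁ : ModelWithCorners ℝ E₁ H₁} [I₁.Boundaryless]
    {M₁ : Type*} [TopologicalSpace M₁] [T2Space M₁] [ChartedSpace H₁ M₁] [IsManifold I₁ ∞ M₁]
    {E₂ : Type*} [NormedAddCommGroup E₂] [NormedSpace ℝ E₂] [FiniteDimensional ℝ E₂]
    {H₂ : Type*} [TopologicalSpace H₂] {I₂ : ModelWithCorners ℝ E₂ H₂} [I₂.Boundaryless]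
    {M₂ : Type*} [TopologicalSpace M₂] [T2Space M₂] [ChartedSpace H₂ M₂] [IsManifold I₂ ∞ M₂]
    {F : Type*} [NormedAddCommGroup F] [NormedSpace ℝ F] [FiniteDimensional ℝ F]
    {G : Type*} [TopologicalSpace G] {J : ModelWithCorners ℝ F G} [J.Boundaryless]
    {N : Type*} [TopologicalSpace N] [T2Space N] [ChartedSpace G N] [IsManifold J ∞ N]
    {F' : Type*} [NormedAddCommGroup F'] [NormedSpace ℝ F'] [FiniteDimensional ℝ F']
    {G' : Type*} [TopologicalSpace G'] {J' : ModelWithCorners ℝ F' G'} [J'.Boundaryless]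
    {N' : Type*} [TopologicalSpace N'] [T2Space N'] [ChartedSpace G' N'] [IsManifold J' ∞ N']
    {F'' : Type*} [NormedAddCommGroup F''] [NormedSpace ℝ F''] [FiniteDimensional ℝ F'']
    {G'' : Type*} [TopologicalSpace G''] {J'' : ModelWithCorners ℝ F'' G''} [J''.Boundaryless]
    {N'' : Type*} [TopologicalSpace N''] [T2Space N''] [ChartedSpace G'' N'']
    [IsManifold J'' ∞ N'']
    (Q₁ : QuasiPoisson.ActionTensor 𝔤 I₁ M₁) (Q₂ : QuasiPoisson.ActionTensor 𝔤 I₂ M₂)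
    (P : QuasiPoisson.ActionTensor 𝔤 J N) (P' : QuasiPoisson.ActionTensor 𝔤 J' N')
    (P'' : QuasiPoisson.ActionTensor 𝔤 J'' N'')
    (μL : M₁ → N) (μR : M₁ → N') (νL : M₂ → N') (νR : M₂ → N'')
    (hμ : QuasiPoisson.IsCentralPair t Q₁ P P' μL μR)
    (hν : QuasiPoisson.IsCentralPair t Q₂ P' P'' νL νR) :
    (QuasiPoisson.fusion t Q₁ Q₂).IsQuasiPoisson t ∧
    (((∀ x, Function.Surjective (mfderiv I₁ J' μR x)) ∨
        (∀ y, Function.Surjective (mfderiv I₂ J' νL y))) →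
      QuasiPoisson.IsTransverseToDiagonal I₁ I₂ J' μR νL) ∧
    (QuasiPoisson.IsTransverseToDiagonal I₁ I₂ J' μR νL →
      ∃ (k : ℕ)
        (_ : ChartedSpace (EuclideanSpace ℝ (Fin k)) (QuasiPoisson.fibreProduct μR νL))
        (_ : IsManifold (𝓡 k) ∞ (QuasiPoisson.fibreProduct μR νL))
        (Q : QuasiPoisson.ActionTensor 𝔤 (𝓡 k) (QuasiPoisson.fibreProduct μR νL)),
        QuasiPoisson.IsQuasiPoissonSubmanifold t (QuasiPoisson.fusion t Q₁ Q₂)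
          (QuasiPoisson.fibreProduct μR νL) Q ∧
        QuasiPoisson.IsCentralPair t Q P P''
          (fun p : QuasiPoisson.fibreProduct μR νL => μL p.1.1)
          (fun p : QuasiPoisson.fibreProduct μR νL => νR p.1.2)) := by
  have hfs := hμ.right_central.smooth
  have hgs := hν.left_central.smooth
  have hfd : ∀ x, MDifferentiableAt I₁ J' μR x := fun x => hfs.mdifferentiableAt (by simp)
  have hgd : ∀ y, MDifferentiableAt I₂ J' νL y := fun y => hgs.mdifferentiableAt (by simp)
  have hfus := QuasiPoisson.isQuasiPoisson_fusion ht_symm ht_inv hμ.isQuasiPoisson hν.isQuasiPoisson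
  refine ⟨hfus, QuasiPoisson.isTransverseToDiagonal_of_surjective hfd hgd, fun htr => ?_⟩
  obtain ⟨k, hcs, hman, hι, htan⟩ := QuasiPoisson.exists_isSmoothEmbedding_fibreProduct hfs hgs
    ((QuasiPoisson.isTransverseToDiagonal_iff hfd hgd).1 htr)
  choose r hr using fun p => (htan p).1
  have hmap : QuasiPoisson.IsQuasiPoissonMap
      (QuasiPoisson.inducedTensor (QuasiPoisson.fusion t Q₁ Q₂) Subtype.val r)
      (QuasiPoisson.fusion t Q₁ Q₂)
      (Subtype.val : QuasiPoisson.fibreProduct μR νL → M₁ × M₂) := by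
    refine QuasiPoisson.isQuasiPoissonMap_inducedTensor hι.contMDiff hr hfus.skew
      (fun u p => (htan p).2 _ (QuasiPoisson.mfderivDifference_fusion_ρ
        hμ.right_central.equivariant hν.left_central.equivariant u p.2))
      fun p α β hα => QuasiPoisson.fusion_pi_eq_zero_of_conormal ht_symm hμ.right_central
        hν.left_central hμ.isQuasiPoisson.skew p.2 (fun v hv => ?_) β
    obtain ⟨w, rfl⟩ := (htan p).2 v hv
    exact DFunLike.congr_fun hα w
  have hQ := hmap.isQuasiPoisson ht_symm ht_inv hfus hr
  refine ⟨k, hcs, hman, _, ⟨hι, hQ, hmap⟩, hQ, hμ.commutative_left, hν.commutative_right,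
    ⟨hμ.left_central.smooth.comp (contMDiff_fst.comp hmap.smooth), ?_, fun a ha => ?_⟩,
    ⟨hν.right_central.smooth.comp (contMDiff_snd.comp hmap.smooth), ?_, fun b hb => ?_⟩⟩
  · exact hμ.left_central.equivariant.comp
      (QuasiPoisson.isEquivariant_fst.comp hmap.equivariant (fun _ => mdifferentiableAt_fst)
        fun _ => hmap.smooth.mdifferentiableAt (by simp))
      (fun _ => hμ.left_central.smooth.mdifferentiableAt (by simp))
      fun _ => (contMDiff_fst.comp hmap.smooth).mdifferentiableAt (by simp)
  · have h := ha.comp hμ.left_central.smooth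
    exact ((hμ.left_central.central a ha).comp_fst h).comp_isQuasiPoissonMap
      (h.comp contMDiff_fst) hmap hr
  · exact hν.right_central.equivariant.comp
      (QuasiPoisson.isEquivariant_snd.comp hmap.equivariant (fun _ => mdifferentiableAt_snd)
        fun _ => hmap.smooth.mdifferentiableAt (by simp))
      (fun _ => hν.right_central.smooth.mdifferentiableAt (by simp))
      fun _ => (contMDiff_snd.comp hmap.smooth).mdifferentiableAt (by simp)
  · have h := hb.comp hν.right_central.smooth
    exact ((hν.right_central.central b hb).comp_snd h).comp_isQuasiPoissonMap
      (h.comp contMDiff_snd) hmap hr
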